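/- All surfaces are orientable (and oriented). A rooted loopless dipole is a 2-cell embedding of a loopless graph with exactly two vertices, with a distinguished root vertex and root edge, up to orientation-preserving isomorphism. The corner at the root vertex between the root edge and the next edge counterclockwise is the root corner, and the face containing it is the root face. Write $n(D)$, $m(D)$ for the numbers of edges and faces and $g(D)=\frac12(n(D)-m(D))$ for the genus; let $\mathcal D$ be the set of rooted dipoles and $\widehat{\mathcal D}$ the set of rooted dipoles with a second distinguished (secondary) edge, different from the root edge. For $D\in\widehat{\mathcal D}$, Region 1 (resp. 2) is the part of the neighbourhood of the root vertex swept counterclockwise from the root edge to the secondary edge (resp. from the secondary edge to the root edge); Regions 3 and 4 are defined in the same way at the non-root vertex. An edge other than the root and secondary edges is an $a$-, $b$-, $c$- or $d$-edge if its ends lie in Regions $(2,3)$, $(1,3)$, $(2,4)$ or $(1,4)$, respectively; the numbers of these edges are $\alpha(D),\beta(D),\gamma(D),\delta(D)$. Corners at the root vertex are marked $\bullet$ in Region 1 and $\circ$ in Region 2. Let $R(D)$ be the string of marks met on a counterclockwise boundary walk of the root face starting at the root corner, and $\Lambda(D)$ the multiset of cyclic strings met on counterclockwise boundary walks of the non-root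 faces. For a binary string $S$, let $(S)$ be the multiset of its cyclic shifts, and let $\mathcal S(\circ,\bullet)$ be the set of all such $(S)$. Let $g_R$ ($R\in\{\circ,\bullet\}^*$) and $f_{(S)}$ ($(S)\in\mathcal S(\circ,\bullet)$) be indeterminates, and for a multiset $\Lambda$ of cyclic strings put $f_\Lambda=\prod_{(S)\in\Lambda}f_{(S)}$. Define $$A=g_\bullet\sum_{D\in\mathcal D}\frac{x^{n(D)}}{n(D)!}u^{2g(D)}f_{\lambda(D)},\qquad B=\sum_{D\in\widehat{\mathcal D},\ \gamma(D)=\delta(D)=0}\frac{x^{\alpha(D)+1}}{(\alpha(D)+1)!}\frac{y^{\beta(D)}}{\beta(D)!}u^{2g(D)}g_{R(D)}f_{\Lambda(D)},$$ where $f_{\lambda(D)}=\prod_i f_{(\circ^{\lambda_i})}$ if the faces of $D$ have degrees $2\lambda_1,2\lambda_2,\dots$. Both are formal power series in $x,y,u$ with coefficients in the polynomial ring over $\mathbb Q$ in the $g_R$ and $f_{(S)}$. Lemma. $B$ is the unique formal power series in $x,y,u$ over this polynomial ring which satisfies $$(C'+u^2J')B=\frac{\partial B}{\partial y},\qquad B|_{y=0}=A,$$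 where, with $R=R_1\cdots R_{\ell(R)}$, $$C'=\sum_{R\in\{\circ,\bullet\}^*}\Bigl(\sum_{2\le i\le \ell(R)}g_{R_1\cdots R_i}\,f_{(R_1R_{i+1}\cdots R_{\ell(R)})}\Bigr)\frac{\partial}{\partial g_R},$$ $$J'=\sum_{R\in\{\circ,\bullet\}^*,\ R\neq\varepsilon}\ \sum_{(S)\in\mathcal S(\circ,\bullet)}\Bigl(\sum_{S\in(S)}g_{RR_1S}\Bigr)\frac{\partial^2}{\partial g_R\,\partial f_{(S)}},$$ the innermost sum running over the cyclic shifts with multiplicity. -/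

import Mathlib

noncomputable section

namespace JoinCut

open Equiv.Perm

/-! ### Indeterminates and series -/

/-- The two symbols marking the corners at the root vertex. -/
inductive Dot
  | black
  | white

/-- The ring `ℚ[g_R, f_(S)]`: one indeterminate `g_R` for every binary string `R`, and one
indeterminate `f_(S)` for every cyclic binary string `(S)`. -/
abbrev MarkPoly := MvPolynomial (List Dot ⊕ Cycle Dot) ℚ

def g (R : List Dot) : MarkPoly := MvPolynomial.X (Sum.inl R)

def f (S : Cycle Dot) : MarkPoly := MvPolynomial.X (Sum.inr S)

inductive SeriesVar
  | x
  | y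
  | u

/-- Formal power series in `x, y, u` whose coefficients are polynomials in the `g_R, f_(S)`. -/
abbrev DipoleSeries := MvPowerSeries SeriesVar MarkPoly

/-- The formal sum of a family of series, computed coefficient by coefficient. It is used only
for families in which every coefficient is non-zero in finitely many members
(see `finite_rootedDipole_coeff` and `finite_ab00_coeff`). -/
def formalSum {ι : Type} (w : ι → DipoleSeries) : DipoleSeries :=
  fun m => ∑ᶠ i, MvPowerSeries.coeff m (w i)

/-! ### Boundary walks of faces -/

/-- The cyclic string read off along the orbit of `e` under `φ`, starting at `e`: if the orbit
is `e, φ e, …, φ^(l-1) e`, the string is `mark e, mark (φ e), …, mark (φ^(l-1) e)`. -/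
def walk {E : Type} (φ : Equiv.Perm E) (mark : E → Dot) (e : E) : List Dot :=
  (List.range (Function.minimalPeriod φ e)).map fun i => mark ((φ ^ i) e)

/-- The faces are the orbits of the face permutation. -/
abbrev Face {E : Type} (φ : Equiv.Perm E) : Type := Quotient (SameCycle.setoid φ)

theorem walk_apply {E : Type} [Finite E] (φ : Equiv.Perm E) (mark : E → Dot) (e : E) :
    walk φ mark (φ e) = (walk φ mark e).rotate 1 := by
  have hmem : e ∈ Function.periodicPts φ := by
    have h := φ.injective.mem_periodicPts e
    exact h
  have hp : Function.minimalPeriod φ (φ e) = Function.minimalPeriod φ e :=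
    Function.minimalPeriod_apply hmem
  have hper : (φ ^ Function.minimalPeriod φ e) e = e := by
    rw [← iterate_eq_pow]
    exact Function.iterate_minimalPeriod
  apply List.ext_getElem
  · simp [walk, hp]
  · intro i h1 h2
    have hi : i < Function.minimalPeriod φ e := by simpa [walk, hp] using h1
    simp only [walk, List.getElem_map, List.getElem_range, List.getElem_rotate,
      List.length_map, List.length_range]
    have hs : (φ ^ i) (φ e) = (φ ^ (i + 1)) e := by rw [pow_succ]; rfl
    rw [hs]
    rcases Nat.lt_or_ge (i + 1) (Function.minimalPeriod φ e) with h | h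
    · rw [Nat.mod_eq_of_lt h]
    · have : i + 1 = Function.minimalPeriod φ e := by omega
      rw [this, hper, Nat.mod_self, pow_zero, one_apply]

theorem walk_isRotated {E : Type} [Finite E] (φ : Equiv.Perm E) (mark : E → Dot) {e e' : E}
    (h : φ.SameCycle e e') : walk φ mark e ~r walk φ mark e' := by
  obtain ⟨i, -, rfl⟩ := h.exists_pow_eq'
  clear h
  induction i with
  | zero => exact List.IsRotated.refl _
  | succ k ih =>
    refine ih.trans ⟨1, ?_⟩
    rw [← walk_apply, pow_succ']
    rfl

/-- The cyclic string of symbols read off along the boundary of a face. -/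
def faceWord {E : Type} [Finite E] (φ : Equiv.Perm E) (mark : E → Dot) :
    Face φ → Cycle Dot :=
  Quotient.lift (fun e => (walk φ mark e : Cycle Dot)) fun _ _ h =>
    Cycle.coe_eq_coe.2 (walk_isRotated φ mark h)

theorem walk_congr {E E' : Type} {φ : Equiv.Perm E} {φ' : Equiv.Perm E'} (π : E ≃ E')
    (hπ : ∀ e, π (φ e) = φ' (π e)) {mark : E → Dot} {mark' : E' → Dot}
    (hm : ∀ e, mark' (π e) = mark e) (e : E) : walk φ' mark' (π e) = walk φ mark e := by
  have hpow : ∀ i e, (φ' ^ i) (π e) = π ((φ ^ i) e) := by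
    intro i
    induction i with
    | zero => intro e; rfl
    | succ k ih => intro e; rw [pow_succ, pow_succ, mul_apply, mul_apply, ← hπ, ih]
  have hper : Function.minimalPeriod φ' (π e) = Function.minimalPeriod φ e := by
    apply Function.minimalPeriod_eq_minimalPeriod_iff.2
    intro n
    simp only [Function.IsPeriodicPt, Function.IsFixedPt, iterate_eq_pow, hpow,
      EmbeddingLike.apply_eq_iff_eq]
  simp only [walk, hper, hpow, hm]

theorem sameCycle_congr {E E' : Type} {φ : Equiv.Perm E} {φ' : Equiv.Perm E'} (π : E ≃ E')
    (hπ : ∀ e, π (φ e) = φ' (π e)) (e₁ e₂ : E) :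
    φ'.SameCycle (π e₁) (π e₂) ↔ φ.SameCycle e₁ e₂ := by
  have h : φ' = π.permCongr φ := by
    ext z
    simp [Equiv.permCongr_apply, hπ]
  subst h
  have hz : ∀ (i : ℤ) e, ((π.permCongr φ) ^ i) (π e) = π ((φ ^ i) e) := by
    intro i e
    have : (π.permCongr φ) ^ i = π.permCongr (φ ^ i) := (map_zpow π.permCongrHom φ i).symm
    rw [this]
    simp [Equiv.permCongr_apply]
  simp only [SameCycle, hz, EmbeddingLike.apply_eq_iff_eq]

/-- The bijection of faces induced by an isomorphism. -/
def faceEquiv {E E' : Type} {φ : Equiv.Perm E} {φ' : Equiv.Perm E'} (π : E ≃ E')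
    (hπ : ∀ e, π (φ e) = φ' (π e)) : Face φ ≃ Face φ' :=
  Quotient.congr π fun e₁ e₂ => (sameCycle_congr π hπ e₁ e₂).symm

theorem faceWord_congr {E E' : Type} [Finite E] [Finite E'] {φ : Equiv.Perm E}
    {φ' : Equiv.Perm E'} (π : E ≃ E') (hπ : ∀ e, π (φ e) = φ' (π e)) {mark : E → Dot}
    {mark' : E' → Dot} (hm : ∀ e, mark' (π e) = mark e) (F : Face φ) :
    faceWord φ' mark' (faceEquiv π hπ F) = faceWord φ mark F := by
  induction F using Quotient.inductionOn with
  | h e => exact congrArg _ (walk_congr π hπ hm e)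

/-! ### Rooted dipoles -/

/-- A rooted loopless dipole in an oriented surface, with edges labelled by `Fin n`, as a
rotation system: every edge joins the two vertices, so the counterclockwise order of the edge
ends around the root vertex and around the other vertex are two cyclic permutations of the set
of all edges. -/
structure LabelledDipole where
  n : ℕ
  rootRot : Equiv.Perm (Fin n)
  otherRot : Equiv.Perm (Fin n)
  rootRot_full : ∀ e e', rootRot.SameCycle e e'
  otherRot_full : ∀ e e', otherRot.SameCycle e e'
  root : Fin n

namespace LabelledDipole

/-- The edge `e` stands for the corner at the root vertex lying between `e` and the edge
following `e` counterclockwise. A counterclockwise boundary walk of the face containing this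
corner leaves the corner along `e`, then follows the edge preceding `e` counterclockwise at
the other vertex back to the root vertex; the corner reached there is the next one. In
particular `D.root` stands for the root corner. -/
def facePerm (D : LabelledDipole) : Equiv.Perm (Fin D.n) := D.rootRot⁻¹ * D.otherRot⁻¹

def numFaces (D : LabelledDipole) : ℕ := Nat.card (Face D.facePerm)

/-- The genus, from the Euler–Poincaré formula `2 - n + m = 2 - 2 * genus`. -/
def genus (D : LabelledDipole) : ℕ := (D.n - D.numFaces) / 2

/-- `π` is an orientation preserving isomorphism of rooted dipoles. -/
structure IsIso (D D' : LabelledDipole) (π : Fin D.n ≃ Fin D'.n) : Prop where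
  rootRot : ∀ e, π (D.rootRot e) = D'.rootRot (π e)
  otherRot : ∀ e, π (D.otherRot e) = D'.otherRot (π e)
  root : π D.root = D'.root

instance setoid : Setoid LabelledDipole where
  r D D' := ∃ π, IsIso D D' π
  iseqv :=
    { refl := fun D => ⟨Equiv.refl _, fun _ => rfl, fun _ => rfl, rfl⟩
      symm := by
        rintro D D' ⟨π, h1, h2, h3⟩
        refine ⟨π.symm, fun e => ?_, fun e => ?_, ?_⟩
        · rw [Equiv.symm_apply_eq, h1, Equiv.apply_symm_apply]
        · rw [Equiv.symm_apply_eq, h2, Equiv.apply_symm_apply]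
        · rw [Equiv.symm_apply_eq, h3]
      trans := by
        rintro D D' D'' ⟨π, h1, h2, h3⟩ ⟨ρ, k1, k2, k3⟩
        refine ⟨π.trans ρ, fun e => ?_, fun e => ?_, ?_⟩
        · simp [h1, k1]
        · simp [h2, k2]
        · simp [h3, k3] }

/-- `f_{λ(D)}`: the product over all faces of `f_(○^l)`, for a face of degree `2 * l`, that is,
a face with `l` corners at the root vertex. -/
def allWhite (D : LabelledDipole) : MarkPoly :=
  ∏ᶠ F : Face D.facePerm, f (faceWord D.facePerm (fun _ => Dot.white) F)

/-- `x^n / n! * u^(2 * genus) * f_{λ(D)}`. -/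
def weight (D : LabelledDipole) : DipoleSeries :=
  MvPowerSeries.monomial
    (Finsupp.single SeriesVar.x D.n + Finsupp.single SeriesVar.u (2 * D.genus))
    (MvPolynomial.C (1 / (D.n.factorial : ℚ)) * D.allWhite)

variable {D D' : LabelledDipole} {π : Fin D.n ≃ Fin D'.n}

theorem IsIso.n_eq (_ : IsIso D D' π) : D.n = D'.n := by
  simpa using Fintype.card_congr π

theorem IsIso.facePerm (h : IsIso D D' π) (e : Fin D.n) :
    π (D.facePerm e) = D'.facePerm (π e) := by
  have h1 : ∀ e, π (D.rootRot⁻¹ e) = D'.rootRot⁻¹ (π e) := fun e => by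
    rw [eq_inv_iff_eq, ← h.rootRot]; simp
  have h2 : ∀ e, π (D.otherRot⁻¹ e) = D'.otherRot⁻¹ (π e) := fun e => by
    rw [eq_inv_iff_eq, ← h.otherRot]; simp
  simp only [LabelledDipole.facePerm, mul_apply, h1, h2]

theorem IsIso.genus (h : IsIso D D' π) : D.genus = D'.genus := by
  rw [LabelledDipole.genus, LabelledDipole.genus, h.n_eq, numFaces, numFaces,
    Nat.card_congr (faceEquiv π h.facePerm)]

theorem IsIso.allWhite (h : IsIso D D' π) : D.allWhite = D'.allWhite :=
  finprod_eq_of_bijective _ (faceEquiv π h.facePerm).bijective fun F => by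
    rw [faceWord_congr π h.facePerm (fun _ => rfl)]

theorem IsIso.weight (h : IsIso D D' π) : D.weight = D'.weight := by
  rw [LabelledDipole.weight, LabelledDipole.weight, h.n_eq, h.genus, h.allWhite]

end LabelledDipole

/-- Rooted loopless dipoles: isomorphism classes of labelled ones. -/
def RootedDipole : Type := Quotient LabelledDipole.setoid

def RootedDipole.weight : RootedDipole → DipoleSeries :=
  Quotient.lift LabelledDipole.weight fun _ _ ⟨_, h⟩ => h.weight

theorem finite_labelledDipole (N : ℕ) : {D : LabelledDipole | D.n = N}.Finite := by
  refine (Set.finite_range fun p : {p : (Equiv.Perm (Fin N) × Equiv.Perm (Fin N)) × Fin N //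
      (∀ e e', p.1.1.SameCycle e e') ∧ ∀ e e', p.1.2.SameCycle e e'} =>
    (⟨N, p.1.1.1, p.1.1.2, p.2.1, p.2.2, p.1.2⟩ : LabelledDipole)).subset ?_
  rintro ⟨n, s, t, hs, ht, r⟩ rfl
  exact ⟨⟨⟨⟨s, t⟩, r⟩, hs, ht⟩, rfl⟩

theorem finite_rootedDipole_coeff (m : SeriesVar →₀ ℕ) :
    {D : RootedDipole | MvPowerSeries.coeff m D.weight ≠ 0}.Finite := by
  classical
  refine ((finite_labelledDipole (m SeriesVar.x)).image (Quotient.mk _)).subset ?_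
  intro D
  induction D using Quotient.inductionOn with
  | h D =>
    intro hD
    refine ⟨D, ?_, rfl⟩
    change MvPowerSeries.coeff m D.weight ≠ 0 at hD
    rw [LabelledDipole.weight, MvPowerSeries.coeff_monomial] at hD
    have hm := (ite_ne_right_iff.1 hD).1
    simp [hm]

/-- The `(a,0,0,0)`-dipole series `A`. -/
def seriesA : DipoleSeries :=
  MvPowerSeries.C (g [Dot.black]) * formalSum RootedDipole.weight

/-! ### Birooted dipoles -/

/-- A rooted dipole with a second distinguished edge. -/
structure LabelledBirooted extends LabelledDipole where
  secondary : Fin n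
  secondary_ne_root : secondary ≠ root

namespace LabelledBirooted

/-- The number of steps from the root edge to `e`, counterclockwise around the root vertex. -/
def rootPos (D : LabelledBirooted) (e : Fin D.n) : ℕ :=
  sInf {k : ℕ | (D.rootRot ^ k) D.root = e}

/-- The number of steps from the root edge to `e`, counterclockwise around the other vertex. -/
def otherPos (D : LabelledBirooted) (e : Fin D.n) : ℕ :=
  sInf {k : ℕ | (D.otherRot ^ k) D.root = e}

/-- Region 1: at the root vertex, counterclockwise from the root to the secondary edge. -/
def InRegion1 (D : LabelledBirooted) (e : Fin D.n) : Prop :=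
  0 < D.rootPos e ∧ D.rootPos e < D.rootPos D.secondary

/-- Region 2: at the root vertex, counterclockwise from the secondary to the root edge. -/
def InRegion2 (D : LabelledBirooted) (e : Fin D.n) : Prop :=
  D.rootPos D.secondary < D.rootPos e

/-- Region 3: at the other vertex, counterclockwise from the root to the secondary edge. -/
def InRegion3 (D : LabelledBirooted) (e : Fin D.n) : Prop :=
  0 < D.otherPos e ∧ D.otherPos e < D.otherPos D.secondary

/-- Region 4: at the other vertex, counterclockwise from the secondary to the root edge. -/
def InRegion4 (D : LabelledBirooted) (e : Fin D.n) : Prop :=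
  D.otherPos D.secondary < D.otherPos e

/-- The number of `a`-edges. -/
def alpha (D : LabelledBirooted) : ℕ := Nat.card {e // D.InRegion2 e ∧ D.InRegion3 e}

/-- The number of `b`-edges. -/
def beta (D : LabelledBirooted) : ℕ := Nat.card {e // D.InRegion1 e ∧ D.InRegion3 e}

/-- The number of `c`-edges. -/
def gamma (D : LabelledBirooted) : ℕ := Nat.card {e // D.InRegion2 e ∧ D.InRegion4 e}

/-- The number of `d`-edges. -/
def delta (D : LabelledBirooted) : ℕ := Nat.card {e // D.InRegion1 e ∧ D.InRegion4 e}

/-- The mark of the corner between `e` and the edge following it at the root vertex: black if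
the corner is in Region 1, white if it is in Region 2. -/
def mark (D : LabelledBirooted) (e : Fin D.n) : Dot :=
  if D.rootPos e < D.rootPos D.secondary then Dot.black else Dot.white

/-- `R(D)`: the string read off along the root face, starting at the root corner. -/
def rootWord (D : LabelledBirooted) : List Dot := walk D.facePerm D.mark D.root

/-- `f_{Λ(D)}`: the product of `f_(S)` over the cyclic strings `(S)` of the non-root faces. -/
def nonRootFaces (D : LabelledBirooted) : MarkPoly :=
  ∏ᶠ (F : Face D.facePerm) (_ : F ≠ Quotient.mk _ D.root), f (faceWord D.facePerm D.mark F)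

/-- `x^(α+1) / (α+1)! * y^β / β! * u^(2 * genus) * g_{R(D)} * f_{Λ(D)}`. -/
def weight (D : LabelledBirooted) : DipoleSeries :=
  MvPowerSeries.monomial
    (Finsupp.single SeriesVar.x (D.alpha + 1) + Finsupp.single SeriesVar.y D.beta +
      Finsupp.single SeriesVar.u (2 * D.genus))
    (MvPolynomial.C (1 / ((D.alpha + 1).factorial : ℚ) * (1 / (D.beta.factorial : ℚ))) *
      (g D.rootWord * D.nonRootFaces))

/-- `π` is an orientation preserving isomorphism of birooted dipoles. -/
structure IsIso (D D' : LabelledBirooted) (π : Fin D.n ≃ Fin D'.n) : Prop where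
  toDipole : LabelledDipole.IsIso D.toLabelledDipole D'.toLabelledDipole π
  secondary : π D.secondary = D'.secondary

instance setoid : Setoid LabelledBirooted where
  r D D' := ∃ π, IsIso D D' π
  iseqv :=
    { refl := fun D => ⟨Equiv.refl _, ⟨fun _ => rfl, fun _ => rfl, rfl⟩, rfl⟩
      symm := by
        rintro D D' ⟨π, ⟨h1, h2, h3⟩, h4⟩
        refine ⟨π.symm, ⟨fun e => ?_, fun e => ?_, ?_⟩, ?_⟩
        · rw [Equiv.symm_apply_eq, h1, Equiv.apply_symm_apply]
        · rw [Equiv.symm_apply_eq, h2, Equiv.apply_symm_apply]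
        · rw [Equiv.symm_apply_eq, h3]
        · rw [Equiv.symm_apply_eq, h4]
      trans := by
        rintro D D' D'' ⟨π, ⟨h1, h2, h3⟩, h4⟩ ⟨ρ, ⟨k1, k2, k3⟩, k4⟩
        refine ⟨π.trans ρ, ⟨fun e => ?_, fun e => ?_, ?_⟩, ?_⟩
        · simp [h1, k1]
        · simp [h2, k2]
        · simp [h3, k3]
        · simp [h4, k4] }

variable {D D' : LabelledBirooted} {π : Fin D.n ≃ Fin D'.n}

theorem pow_congr {E E' : Type} {φ : Equiv.Perm E} {φ' : Equiv.Perm E'} (π : E ≃ E')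
    (hπ : ∀ e, π (φ e) = φ' (π e)) (i : ℕ) (e : E) : (φ' ^ i) (π e) = π ((φ ^ i) e) := by
  induction i generalizing e with
  | zero => rfl
  | succ k ih => rw [pow_succ, pow_succ, mul_apply, mul_apply, ← hπ, ih]

theorem IsIso.rootPos (h : IsIso D D' π) (e : Fin D.n) : D'.rootPos (π e) = D.rootPos e := by
  simp only [LabelledBirooted.rootPos, ← h.toDipole.root, pow_congr π h.toDipole.rootRot,
    EmbeddingLike.apply_eq_iff_eq]

theorem IsIso.otherPos (h : IsIso D D' π) (e : Fin D.n) :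
    D'.otherPos (π e) = D.otherPos e := by
  simp only [LabelledBirooted.otherPos, ← h.toDipole.root, pow_congr π h.toDipole.otherRot,
    EmbeddingLike.apply_eq_iff_eq]

theorem IsIso.alpha (h : IsIso D D' π) : D.alpha = D'.alpha :=
  Nat.card_congr (π.subtypeEquiv fun e => by
    simp only [InRegion2, InRegion3, ← h.secondary, h.rootPos, h.otherPos])

theorem IsIso.beta (h : IsIso D D' π) : D.beta = D'.beta :=
  Nat.card_congr (π.subtypeEquiv fun e => by
    simp only [InRegion1, InRegion3, ← h.secondary, h.rootPos, h.otherPos])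

theorem IsIso.gamma (h : IsIso D D' π) : D.gamma = D'.gamma :=
  Nat.card_congr (π.subtypeEquiv fun e => by
    simp only [InRegion2, InRegion4, ← h.secondary, h.rootPos, h.otherPos])

theorem IsIso.delta (h : IsIso D D' π) : D.delta = D'.delta :=
  Nat.card_congr (π.subtypeEquiv fun e => by
    simp only [InRegion1, InRegion4, ← h.secondary, h.rootPos, h.otherPos])

theorem IsIso.mark (h : IsIso D D' π) (e : Fin D.n) : D'.mark (π e) = D.mark e := by
  simp only [LabelledBirooted.mark, ← h.secondary, h.rootPos]

theorem IsIso.rootWord (h : IsIso D D' π) : D.rootWord = D'.rootWord := by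
  rw [LabelledBirooted.rootWord, LabelledBirooted.rootWord, ← h.toDipole.root,
    walk_congr π h.toDipole.facePerm h.mark]

theorem IsIso.nonRootFaces (h : IsIso D D' π) : D.nonRootFaces = D'.nonRootFaces := by
  refine finprod_eq_of_bijective _ (faceEquiv π h.toDipole.facePerm).bijective fun F => ?_
  have hr : faceEquiv π h.toDipole.facePerm (Quotient.mk _ D.root) = Quotient.mk _ D'.root := by
    rw [← h.toDipole.root]
    rfl
  rw [faceWord_congr π h.toDipole.facePerm h.mark, ← hr]
  simp only [ne_eq, EmbeddingLike.apply_eq_iff_eq]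

theorem IsIso.weight (h : IsIso D D' π) : D.weight = D'.weight := by
  rw [LabelledBirooted.weight, LabelledBirooted.weight, h.alpha, h.beta, h.toDipole.genus,
    h.rootWord, h.nonRootFaces]

end LabelledBirooted

/-- Birooted dipoles: isomorphism classes of labelled ones. -/
def BirootedDipole : Type := Quotient LabelledBirooted.setoid

namespace BirootedDipole

def gamma : BirootedDipole → ℕ :=
  Quotient.lift LabelledBirooted.gamma fun _ _ ⟨_, h⟩ => h.gamma

def delta : BirootedDipole → ℕ :=
  Quotient.lift LabelledBirooted.delta fun _ _ ⟨_, h⟩ => h.delta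

def weight : BirootedDipole → DipoleSeries :=
  Quotient.lift LabelledBirooted.weight fun _ _ ⟨_, h⟩ => h.weight

end BirootedDipole

theorem LabelledBirooted.rootPos_injective (D : LabelledBirooted) :
    Function.Injective D.rootPos := by
  have h : ∀ e, (D.rootRot ^ D.rootPos e) D.root = e := fun e =>
    Nat.sInf_mem (s := {k : ℕ | (D.rootRot ^ k) D.root = e})
      (let ⟨k, _, hk⟩ := (D.rootRot_full D.root e).exists_pow_eq'; ⟨k, hk⟩)
  intro e e' hee
  rw [← h e, ← h e', hee]

theorem LabelledBirooted.otherPos_injective (D : LabelledBirooted) :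
    Function.Injective D.otherPos := by
  have h : ∀ e, (D.otherRot ^ D.otherPos e) D.root = e := fun e =>
    Nat.sInf_mem (s := {k : ℕ | (D.otherRot ^ k) D.root = e})
      (let ⟨k, _, hk⟩ := (D.otherRot_full D.root e).exists_pow_eq'; ⟨k, hk⟩)
  intro e e' hee
  rw [← h e, ← h e', hee]

theorem LabelledBirooted.n_le (D : LabelledBirooted) (hc : D.gamma = 0) (hd : D.delta = 0) :
    D.n ≤ D.alpha + D.beta + 2 := by
  classical
  have hr : D.rootPos D.root = 0 := Nat.sInf_eq_zero.2 (Or.inl rfl)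
  have hr' : D.otherPos D.root = 0 := Nat.sInf_eq_zero.2 (Or.inl rfl)
  have hc' := (Nat.card_eq_zero.1 hc).resolve_right (fun h => h.not_finite inferInstance)
  have hd' := (Nat.card_eq_zero.1 hd).resolve_right (fun h => h.not_finite inferInstance)
  have hcov : (Finset.univ : Finset (Fin D.n)) ⊆
      (Finset.univ.filter (fun e => D.InRegion2 e ∧ D.InRegion3 e) ∪
        Finset.univ.filter (fun e => D.InRegion1 e ∧ D.InRegion3 e)) ∪
        {D.root, D.secondary} := by
    intro e _
    by_cases h1 : e = D.root
    · simp [h1]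
    by_cases h2 : e = D.secondary
    · simp [h2]
    have a1 : D.rootPos e ≠ 0 := fun h => h1 (D.rootPos_injective (h.trans hr.symm))
    have a2 : D.otherPos e ≠ 0 := fun h => h1 (D.otherPos_injective (h.trans hr'.symm))
    have a3 : D.rootPos e ≠ D.rootPos D.secondary := fun h => h2 (D.rootPos_injective h)
    have a4 : D.otherPos e ≠ D.otherPos D.secondary := fun h => h2 (D.otherPos_injective h)
    have c : ¬(D.InRegion2 e ∧ D.InRegion4 e) := fun h => hc'.false ⟨e, h⟩
    have d : ¬(D.InRegion1 e ∧ D.InRegion4 e) := fun h => hd'.false ⟨e, h⟩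
    have key : (D.InRegion2 e ∧ D.InRegion3 e) ∨ (D.InRegion1 e ∧ D.InRegion3 e) := by
      simp only [LabelledBirooted.InRegion1, LabelledBirooted.InRegion2,
        LabelledBirooted.InRegion3, LabelledBirooted.InRegion4] at c d ⊢
      omega
    simpa [h1, h2] using key
  have h := Finset.card_le_card hcov
  rw [Finset.card_univ, Fintype.card_fin] at h
  refine h.trans ((Finset.card_union_le _ _).trans (Nat.add_le_add
    ((Finset.card_union_le _ _).trans (Nat.add_le_add ?_ ?_)) Finset.card_le_two))
  · rw [LabelledBirooted.alpha, Nat.card_eq_fintype_card, Fintype.card_subtype]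
  · rw [LabelledBirooted.beta, Nat.card_eq_fintype_card, Fintype.card_subtype]

theorem finite_labelledBirooted (N : ℕ) : {D : LabelledBirooted | D.n ≤ N}.Finite := by
  have h : {D : LabelledDipole | D.n ≤ N}.Finite := by
    refine ((Set.finite_Iic N).biUnion fun k _ => finite_labelledDipole k).subset ?_
    intro D hD
    exact Set.mem_biUnion (Set.mem_Iic.2 hD) rfl
  have : Finite {D : LabelledDipole // D.n ≤ N} := h
  refine (Set.finite_range fun p : (D : {D : LabelledDipole // D.n ≤ N}) ×
      {s : Fin D.1.n // s ≠ D.1.root} => (⟨p.1.1, p.2.1, p.2.2⟩ : LabelledBirooted)).subset ?_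
  rintro ⟨D, s, hs⟩ hD
  exact ⟨⟨⟨D, hD⟩, ⟨s, hs⟩⟩, rfl⟩

theorem finite_ab00_coeff (m : SeriesVar →₀ ℕ) :
    {D : {D : BirootedDipole // D.gamma = 0 ∧ D.delta = 0} |
      MvPowerSeries.coeff m D.1.weight ≠ 0}.Finite := by
  classical
  refine Set.Finite.of_finite_image (f := Subtype.val) ?_ Subtype.val_injective.injOn
  refine ((finite_labelledBirooted (m SeriesVar.x + m SeriesVar.y + 1)).image
    (Quotient.mk _)).subset ?_
  rintro _ ⟨⟨D, hc, hd⟩, hD, rfl⟩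
  induction D using Quotient.inductionOn with
  | h D =>
    refine ⟨D, ?_, rfl⟩
    change MvPowerSeries.coeff m D.weight ≠ 0 at hD
    rw [LabelledBirooted.weight, MvPowerSeries.coeff_monomial] at hD
    have hm := (ite_ne_right_iff.1 hD).1
    have hn := D.n_le hc hd
    have hx : m SeriesVar.x = D.alpha + 1 := by simp [hm]
    have hy : m SeriesVar.y = D.beta := by simp [hm]
    change D.n ≤ _
    omega

/-- The `(a,b,0,0)`-dipole series `B`: the sum over the dipoles without `c`- and `d`-edges. -/
def seriesB : DipoleSeries :=
  formalSum fun D : {D : BirootedDipole // D.gamma = 0 ∧ D.delta = 0} => D.1.weight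

/-! ### The cut and join operators -/

theorem finite_pderiv_ne_zero (p : MarkPoly) :
    {v | MvPolynomial.pderiv v p ≠ 0}.Finite := by
  refine p.vars.finite_toSet.subset fun v hv => ?_
  by_contra h
  exact hv (MvPolynomial.pderiv_eq_zero_of_notMem_vars h)

/-- `C' p`; only finitely many terms are non-zero, by `finite_pderiv_ne_zero`. Here `R.take 1 ++ R.drop i` is the string `R_1 R_{i+1} ⋯ R_{ℓ(R)}`. -/
def cutPoly (p : MarkPoly) : MarkPoly :=
  ∑ᶠ R : List Dot,
    (∑ i ∈ Finset.Icc 2 R.length,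
        g (R.take i) * f ((R.take 1 ++ R.drop i : List Dot) : Cycle Dot)) *
      MvPolynomial.pderiv (Sum.inl R) p

/-- `J' p`; again only finitely many terms are non-zero. Here `S.lists` is the multiset of cyclic shifts (with multiplicity) that `S` stands
for, and `R ++ R.take 1 ++ T` is the string `R R_1 T`; the empty string `R`, which has no first
symbol, contributes no term. -/
def joinPoly (p : MarkPoly) : MarkPoly :=
  ∑ᶠ (R : List Dot) (_ : R ≠ []), ∑ᶠ S : Cycle Dot,
    (S.lists.map fun T => g (R ++ R.take 1 ++ T)).sum *
      MvPolynomial.pderiv (Sum.inl R) (MvPolynomial.pderiv (Sum.inr S) p)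

/-- `C'` acting on series; `x, y, u` are constants for it. -/
def cutOp (F : DipoleSeries) : DipoleSeries := fun m => cutPoly (MvPowerSeries.coeff m F)

/-- `J'` acting on series; `x, y, u` are constants for it. -/
def joinOp (F : DipoleSeries) : DipoleSeries := fun m => joinPoly (MvPowerSeries.coeff m F)

/-- `F|_{y=0}`. -/
def atYZero (F : DipoleSeries) : DipoleSeries :=
  fun m => if m SeriesVar.y = 0 then MvPowerSeries.coeff m F else 0

end JoinCut

end

/-! A rooted dipole is a pair of full cycles `ρ`, `τ` on its edge set `E`, together with a root `r`.
The position of an edge after `r` identifies it, so up to isomorphism `ρ` and `r` can be fixed once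
and for all. Isomorphism classes then correspond bijectively to the full cycles `τ`, because a
bijection that commutes with `ρ` and fixes `r` is the identity. For birooted dipoles the place of
the secondary edge `s` under `ρ` is fixed by the number `b` of b-edges, and having no c- or d-edges
means exactly `τ s = r`. Hence each coefficient of A or B is a factorial factor times a finite sum
over such `τ` of monomials `g_R f_Λ` (`coeff_seriesA`, `coeff_seriesB`).

The differential equation describes the insertion of a new b-edge. Every configuration with `b + 1`
b-edges arises uniquely from one with `b` by putting an edge directly after the root at the root
vertex, and directly before some `q ≠ r` at the other vertex (`sum_fullCyclesTo_some`). With `φ =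
ρ⁻¹ τ⁻¹` and `p = φ q`, the face permutation is extended by a fixed point and then multiplied by two
transpositions that involve only the new edge, `r` and `p` (`inv_insertEdge_mul_inv_insertEdge`). If
`p` lies on the root face, that face is cut into two: there is one more face and the genus is
unchanged. If `p` lies on another face, that face is spliced into the root face: there is one face
fewer and the genus grows by one. Summing over `p` gives C' and J' (`sum_faceMonomial_insert`). The
forbidden `q = r` is the cut with `i = 1`, which explains the lower bound 2 in C'. The y-derivative
supplies the factor `b + 1` that turns `1/(b+1)!` into `1/b!`.

At `y = 0` the secondary edge is next to the root edge at both vertices, and the two bound a digon.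
Deleting the secondary edge leaves an arbitrary rooted dipole. The root corner is the only black
one, which gives A (`faceMonomial_insertEdge_secondary`).

Uniqueness holds because the equation determines the coefficients at `y^(k+1)` from those at `y^k`.
-/

noncomputable section

namespace JoinCut

open Equiv Equiv.Perm

/-! ### Orbit decompositions of a permutation -/

section Orbits

variable {E : Type} {φ : Perm E}

/-- If each element of a list is followed, cyclically, by its image, the list is an orbit. -/
theorem pow_apply_of_map_eq_rotate {e : E} {t : List E}
    (h : (e :: t).map φ = (e :: t).rotate 1) (k : ℕ) :
    (φ ^ k) e = (e :: t)[k % (e :: t).length]'(Nat.mod_lt _ (by simp)) := by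
  induction k with
  | zero => simp
  | succ k ih =>
    rw [pow_succ', mul_apply, ih]
    have hlt : k % (e :: t).length < (e :: t).length := Nat.mod_lt _ (by simp)
    have h1 : φ ((e :: t)[k % (e :: t).length]) =
        ((e :: t).map φ)[k % (e :: t).length]'(by rw [List.length_map]; exact hlt) := by
      rw [List.getElem_map]
    rw [h1]
    simp only [h, List.getElem_rotate, Nat.mod_add_mod]

/-- By the preceding lemma the k-th iterate is read off at index k modulo the length. Without
repeated entries it returns to `e` only at multiples of the length. -/
theorem minimalPeriod_of_map_eq_rotate {e : E} {t : List E}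
    (h : (e :: t).map φ = (e :: t).rotate 1) (hn : (e :: t).Nodup) :
    Function.minimalPeriod φ e = (e :: t).length := by
  have key : ∀ k, Function.IsPeriodicPt φ k e ↔ (e :: t).length ∣ k := by
    intro k
    rw [Function.IsPeriodicPt, Function.IsFixedPt, iterate_eq_pow, pow_apply_of_map_eq_rotate h]
    have hlt : k % (e :: t).length < (e :: t).length := Nat.mod_lt _ (by simp)
    have h0 : (e :: t)[0] = e := rfl
    conv_lhs => rhs; rw [← h0]
    rw [hn.getElem_inj_iff, Nat.dvd_iff_mod_eq_zero]
  apply Nat.dvd_antisymm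
  · exact ((key _).2 dvd_rfl).minimalPeriod_dvd
  · exact (key _).1 (Function.isPeriodicPt_minimalPeriod _ _)

theorem walk_of_map_eq_rotate {e : E} {t : List E}
    (h : (e :: t).map φ = (e :: t).rotate 1) (hn : (e :: t).Nodup) (mark : E → Dot) :
    walk φ mark e = (e :: t).map mark := by
  apply List.ext_getElem
  · simp [walk, minimalPeriod_of_map_eq_rotate h hn]
  · intro i h1 h2
    have h3 : i < (e :: t).length := by simpa using h2
    simp only [walk, List.getElem_map, List.getElem_range, pow_apply_of_map_eq_rotate h,
      Nat.mod_eq_of_lt h3]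

/-- The orbit of `e`, starting at `e`. -/
def orbitList (φ : Perm E) (e : E) : List E :=
  (List.range (Function.minimalPeriod φ e)).map fun i => (φ ^ i) e

theorem orbitList_nodup (φ : Perm E) (e : E) : (orbitList φ e).Nodup := by
  refine List.Nodup.map_on ?_ List.nodup_range
  intro i hi j hj hij
  rw [← iterate_eq_pow, ← iterate_eq_pow] at hij
  exact Function.iterate_injOn_Iio_minimalPeriod (List.mem_range.1 hi) (List.mem_range.1 hj) hij

theorem minimalPeriod_pos [Finite E] (φ : Perm E) (e : E) : 0 < Function.minimalPeriod φ e :=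
  Function.minimalPeriod_pos_of_mem_periodicPts (φ.injective.mem_periodicPts e)

theorem orbitList_eq_cons [Finite E] (φ : Perm E) (e : E) : ∃ t, orbitList φ e = e :: t := by
  obtain ⟨k, hk⟩ := Nat.exists_eq_succ_of_ne_zero (minimalPeriod_pos φ e).ne'
  refine ⟨((List.range k).map Nat.succ).map fun i => (φ ^ i) e, ?_⟩
  rw [orbitList, hk, List.range_succ_eq_map]
  rfl

theorem mem_orbitList [Finite E] {φ : Perm E} {e e' : E} :
    e' ∈ orbitList φ e ↔ φ.SameCycle e e' := by
  rw [orbitList, List.mem_map]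
  constructor
  · rintro ⟨i, -, rfl⟩
    exact ⟨i, by simp⟩
  · intro h
    obtain ⟨i, -, rfl⟩ := h.exists_pow_eq'
    refine ⟨i % Function.minimalPeriod φ e,
      List.mem_range.2 (Nat.mod_lt _ (minimalPeriod_pos φ e)), ?_⟩
    rw [← iterate_eq_pow, ← iterate_eq_pow, Function.iterate_mod_minimalPeriod_eq]

theorem map_orbitList [Finite E] (φ : Perm E) (e : E) :
    (orbitList φ e).map φ = (orbitList φ e).rotate 1 := by
  have hper : (φ ^ Function.minimalPeriod φ e) e = e := by
    rw [← iterate_eq_pow]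
    exact Function.iterate_minimalPeriod
  apply List.ext_getElem
  · simp
  · intro i h1 h2
    have hi : i < Function.minimalPeriod φ e := by simpa [orbitList] using h1
    simp only [orbitList, List.getElem_map, List.getElem_range, List.getElem_rotate,
      List.length_map, List.length_range]
    rw [← mul_apply, ← pow_succ']
    rcases Nat.lt_or_ge (i + 1) (Function.minimalPeriod φ e) with h | h
    · rw [Nat.mod_eq_of_lt h]
    · have : i + 1 = Function.minimalPeriod φ e := by omega
      rw [this, hper, Nat.mod_self, pow_zero, one_apply]

/-- `M` lists every orbit of `φ` exactly once. -/
structure IsDecomp [Fintype E] (φ : Perm E) (M : Multiset (List E)) : Prop where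
  ne_nil : ∀ l ∈ M, l ≠ []
  map_eq : ∀ l ∈ M, l.map φ = l.rotate 1
  cover : M.bind (fun l => (l : Multiset E)) = Finset.univ.val

variable [Fintype E]

theorem IsDecomp.nodup_of_mem {M : Multiset (List E)} (h : IsDecomp φ M) {l : List E}
    (hl : l ∈ M) : l.Nodup := by
  have hn : (M.bind (fun l => (l : Multiset E))).Nodup := h.cover ▸ Finset.univ.nodup
  exact Multiset.coe_nodup.1 ((Multiset.nodup_bind.1 hn).1 l hl)

/-- The orbit of `r` is singled out and started at `r`, since the root word depends on its starting
point. The starting points of the other orbits do not matter. -/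
theorem exists_isDecomp (φ : Perm E) (r : E) :
    ∃ (t : List E) (N : Multiset (List E)), IsDecomp φ ((r :: t) ::ₘ N) := by
  classical
  -- An arbitrary choice of representatives, corrected so that the root face is represented by `r`.
  let rep : Face φ → E := Function.update Quotient.out (Quotient.mk _ r) r
  have hrep : ∀ F, (Quotient.mk _ (rep F) : Face φ) = F := by
    intro F
    by_cases hF : F = Quotient.mk _ r
    · subst hF; simp [rep]
    · simp [rep, Function.update_of_ne hF]
  obtain ⟨t, ht⟩ := orbitList_eq_cons φ r
  refine ⟨t, ((Finset.univ : Finset (Face φ)).val.erase (Quotient.mk _ r)).map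
    fun F => orbitList φ (rep F), ?_⟩
  have hM : (r :: t) ::ₘ ((Finset.univ : Finset (Face φ)).val.erase (Quotient.mk _ r)).map
      (fun F => orbitList φ (rep F)) =
      (Finset.univ : Finset (Face φ)).val.map fun F => orbitList φ (rep F) := by
    conv_rhs => rw [← Multiset.cons_erase (Finset.mem_univ_val (Quotient.mk _ r : Face φ))]
    rw [Multiset.map_cons]
    simp [rep, ht]
  rw [hM]
  constructor
  · intro l hl
    obtain ⟨F, -, rfl⟩ := Multiset.mem_map.1 hl
    obtain ⟨t', ht'⟩ := orbitList_eq_cons φ (rep F)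
    simp [ht']
  · intro l hl
    obtain ⟨F, -, rfl⟩ := Multiset.mem_map.1 hl
    exact map_orbitList _ _
  · ext e
    rw [Multiset.count_bind, Multiset.map_map, Multiset.count_univ]
    have : ∀ F : Face φ, Multiset.count e (orbitList φ (rep F) : Multiset E) =
        if F = Quotient.mk _ e then 1 else 0 := by
      intro F
      rw [Multiset.count_eq_of_nodup (Multiset.coe_nodup.2 (orbitList_nodup _ _))]
      congr 1
      rw [Multiset.mem_coe, mem_orbitList, eq_iff_iff]
      conv_rhs => rw [← hrep F]
      exact (@Quotient.eq _ (SameCycle.setoid φ) _ _).symm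
    simp only [Function.comp_def, this]
    change ∑ F : Face φ, _ = 1
    simp

/-- This passes from products over the quotient `Face φ` to products over explicit lists. The
default `r` of `headD` is never used, because the lists are nonempty. -/
theorem IsDecomp.map_mk_head {M : Multiset (List E)} (h : IsDecomp φ M) (r : E) :
    M.map (fun l => (Quotient.mk _ (l.headD r) : Face φ)) =
      (@Finset.univ (Face φ) (Fintype.ofFinite _)).val := by
  have hn : (M.bind (fun l => (l : Multiset E))).Nodup := h.cover ▸ Finset.univ.nodup
  have hmem : ∀ e, ∃ l ∈ M, e ∈ l := fun e => by
    have : e ∈ M.bind (fun l => (l : Multiset E)) := h.cover ▸ Finset.mem_univ e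
    simpa using this
  have hface : ∀ l ∈ M, ∀ e, e ∈ l ↔
      (Quotient.mk _ (l.headD r) : Face φ) = Quotient.mk _ e := by
    intro l hl e
    obtain ⟨a, t, rfl⟩ := List.exists_cons_of_ne_nil (h.ne_nil l hl)
    have hp := pow_apply_of_map_eq_rotate (h.map_eq _ hl)
    rw [List.headD_cons, Quotient.eq]
    change _ ↔ φ.SameCycle a e
    constructor
    · intro he
      obtain ⟨i, hi, rfl⟩ := List.getElem_of_mem he
      refine ⟨i, ?_⟩
      rw [zpow_natCast, hp]
      simp only [Nat.mod_eq_of_lt hi]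
    · intro he
      obtain ⟨i, -, rfl⟩ := he.exists_pow_eq'
      rw [hp]
      exact List.getElem_mem _
  refine (Multiset.Nodup.ext ?_ (Finset.nodup _)).2 ?_
  · induction M using Quotient.inductionOn with
    | h L =>
      change ((L : Multiset (List E)).bind (fun l => (l : Multiset E))).Nodup at hn
      rw [Multiset.coe_bind, Multiset.coe_nodup, List.flatMap_id', List.nodup_flatten] at hn
      change (Multiset.map _ (L : Multiset (List E))).Nodup
      rw [Multiset.map_coe, Multiset.coe_nodup, List.Nodup, List.pairwise_map]
      refine hn.2.imp_of_mem ?_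
      intro a b ha hb hab he
      obtain ⟨x, t, rfl⟩ := List.exists_cons_of_ne_nil (h.ne_nil b hb)
      refine hab ((hface a ha x).2 ?_) List.mem_cons_self
      simpa using he
  · intro F
    simp only [Finset.mem_univ_val, iff_true]
    induction F using Quotient.inductionOn with
    | h e =>
      obtain ⟨l, hl, he⟩ := hmem e
      exact Multiset.mem_map.2 ⟨l, hl, (hface l hl e).1 he⟩

/-- `g_R f_Λ`, where `R` is read off along the orbit of `r`, starting at `r`, and `Λ` along the
other orbits. -/
def faceMonomial {E : Type} [Finite E] (φ : Perm E) (mark : E → Dot) (r : E) : MarkPoly :=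
  g (walk φ mark r) *
    ∏ᶠ (F : Face φ) (_ : F ≠ Quotient.mk _ r), f (faceWord φ mark F)

theorem IsDecomp.card_face {M : Multiset (List E)} (h : IsDecomp φ M) :
    Nat.card (Face φ) = Multiset.card M := by
  classical
  rcases isEmpty_or_nonempty E with hE | ⟨⟨r⟩⟩
  · have : M = 0 := by
      refine Multiset.eq_zero_of_forall_notMem fun l hl => ?_
      obtain ⟨a, t, rfl⟩ := List.exists_cons_of_ne_nil (h.ne_nil l hl)
      exact hE.false a
    subst this
    have : IsEmpty (Face φ) := ⟨fun F => Quotient.inductionOn F fun e => hE.false e⟩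
    simp
  · have := congrArg Multiset.card (h.map_mk_head r)
    rw [Multiset.card_map] at this
    rw [this]
    exact @Nat.card_eq_fintype_card _ (Fintype.ofFinite _)

theorem IsDecomp.faceWord_eq {M : Multiset (List E)} (h : IsDecomp φ M) (mark : E → Dot) (r : E)
    {l : List E} (hl : l ∈ M) :
    faceWord φ mark (Quotient.mk _ (l.headD r)) = (l.map mark : Cycle Dot) := by
  obtain ⟨a, t, rfl⟩ := List.exists_cons_of_ne_nil (h.ne_nil l hl)
  exact congrArg _ (walk_of_map_eq_rotate (h.map_eq _ hl) (h.nodup_of_mem hl) mark)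

/-- Any decomposition whose first list starts at the root computes the weight, so the effect of an
insertion can be tracked on lists alone. -/
theorem IsDecomp.faceMonomial_eq {r : E} {t : List E} {N : Multiset (List E)}
    (h : IsDecomp φ ((r :: t) ::ₘ N)) (mark : E → Dot) :
    faceMonomial φ mark r = g ((r :: t).map mark) *
      (N.map fun l => f (l.map mark : Cycle Dot)).prod := by
  classical
  have hm : (r :: t) ∈ ((r :: t) ::ₘ N) := Multiset.mem_cons_self _ _
  rw [faceMonomial, walk_of_map_eq_rotate (h.map_eq _ hm) (h.nodup_of_mem hm)]
  congr 1
  let _ : Fintype (Face φ) := Fintype.ofFinite _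
  have hu : N.map (fun l => (Quotient.mk _ (l.headD r) : Face φ)) =
      (Finset.univ.erase (Quotient.mk _ r : Face φ)).val := by
    rw [Finset.erase_val, ← h.map_mk_head r, Multiset.map_cons, List.headD_cons,
      Multiset.erase_cons_head]
  have h1 : ∏ᶠ (F : Face φ) (_ : F ≠ Quotient.mk _ r), f (faceWord φ mark F) =
      ∏ F ∈ Finset.univ.erase (Quotient.mk _ r : Face φ), f (faceWord φ mark F) := by
    rw [← finprod_mem_coe_finset]
    simp
  rw [h1, Finset.prod_eq_multiset_prod, ← hu, Multiset.map_map]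
  congr 1
  refine Multiset.map_congr rfl fun l hl => ?_
  rw [Function.comp_apply, h.faceWord_eq mark r (Multiset.mem_cons_of_mem hl)]

theorem IsDecomp.prod_faceWord {M : Multiset (List E)} [Nonempty E]
    (h : IsDecomp φ M) (mark : E → Dot) :
    ∏ᶠ F : Face φ, f (faceWord φ mark F) = (M.map fun l => f (l.map mark : Cycle Dot)).prod := by
  classical
  obtain ⟨r⟩ := ‹Nonempty E›
  let _ : Fintype (Face φ) := Fintype.ofFinite _
  rw [finprod_eq_prod_of_fintype, Finset.prod_eq_multiset_prod, ← h.map_mk_head r,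
    Multiset.map_map]
  congr 1
  refine Multiset.map_congr rfl fun l hl => ?_
  rw [Function.comp_apply, h.faceWord_eq mark r hl]

/-- Lets a non-root face be started at the corner where the new edge enters it. -/
theorem IsDecomp.rotate {l l' : List E} {N : Multiset (List E)} (h : IsDecomp φ (l ::ₘ N))
    (hl : l ~r l') : IsDecomp φ (l' ::ₘ N) := by
  obtain ⟨n, rfl⟩ := hl
  refine ⟨?_, ?_, ?_⟩
  · intro k hk
    rcases Multiset.mem_cons.1 hk with rfl | hk
    · rw [Ne, List.rotate_eq_nil_iff]
      exact h.ne_nil _ (Multiset.mem_cons_self _ _)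
    · exact h.ne_nil _ (Multiset.mem_cons_of_mem hk)
  · intro k hk
    rcases Multiset.mem_cons.1 hk with rfl | hk
    · rw [List.map_rotate, h.map_eq _ (Multiset.mem_cons_self _ _), List.rotate_rotate,
        List.rotate_rotate, add_comm]
    · exact h.map_eq _ (Multiset.mem_cons_of_mem hk)
  · rw [← h.cover, Multiset.cons_bind, Multiset.cons_bind]
    congr 1
    exact Multiset.coe_eq_coe.2 (List.rotate_perm _ _)

theorem IsDecomp.notMem_of_mem {l k : List E} {N : Multiset (List E)}
    (h : IsDecomp φ (l ::ₘ N)) (hk : k ∈ N) {e : E} (he : e ∈ l) : e ∉ k := by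
  have hn : ((l ::ₘ N).bind (fun l => (l : Multiset E))).Nodup := h.cover ▸ Finset.univ.nodup
  rw [Multiset.cons_bind, Multiset.nodup_add] at hn
  exact fun hek => Multiset.disjoint_left.1 hn.2.2 he (Multiset.mem_bind.2 ⟨k, hk, hek⟩)

theorem univ_option_val : (Finset.univ : Finset (Option E)).val =
    none ::ₘ (Finset.univ : Finset E).val.map some := by
  have : (Finset.univ : Finset (Option E)) = Finset.insertNone Finset.univ := by
    ext x; simp
  rw [this]
  rfl

theorem map_some_bind {E : Type} (N : Multiset (List E)) :
    (N.map (List.map some)).bind (fun l => (l : Multiset (Option E))) =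
      (N.bind (fun l => (l : Multiset E))).map some := by
  rw [Multiset.bind_map, Multiset.map_bind]
  simp only [Multiset.map_coe]

end Orbits

/-! ### Inserting an edge -/

section Insertion

variable {E : Type} [DecidableEq E]

/-- The permutation with the new element `none` inserted just before `q` in its cycle. -/
def insertEdge (σ : Perm E) (q : E) : Perm (Option E) :=
  swap none (some q) * optionCongr σ

theorem insertEdge_none (σ : Perm E) (q : E) : insertEdge σ q none = some q := by
  simp [insertEdge]

theorem insertEdge_some_of_eq {σ : Perm E} {q z : E} (h : σ z = q) :
    insertEdge σ q (some z) = none := by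
  simp [insertEdge, h]

theorem insertEdge_some_of_ne {σ : Perm E} {q z : E} (h : σ z ≠ q) :
    insertEdge σ q (some z) = some (σ z) := by
  simp only [insertEdge, mul_apply, optionCongr_apply, Option.map_some]
  exact swap_apply_of_ne_of_ne (by simp) (by simpa using h)

/-- The key local computation: inserting an edge after `r` in `ρ` and before `q` in `τ` changes the
face permutation only by two transpositions that involve the new edge. The second argument `ρ r` of
`insertEdge` puts the new edge immediately after `r`. -/
theorem inv_insertEdge_mul_inv_insertEdge (ρ τ : Perm E) (r q : E) (x : Option E) :
    ((insertEdge ρ (ρ r))⁻¹ * (insertEdge τ q)⁻¹) x =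
      swap none (some r) (swap none (some ((ρ⁻¹ * τ⁻¹) q)) (x.map (ρ⁻¹ * τ⁻¹))) := by
  rw [mul_apply, inv_eq_iff_eq, inv_eq_iff_eq]
  obtain ⟨p, hp⟩ : ∃ p, (ρ⁻¹ * τ⁻¹) q = p := ⟨_, rfl⟩
  have hq : q = τ (ρ p) := by simp [← hp]
  rw [hp]
  rcases x with _ | z
  · by_cases h : p = r
    · subst h
      simp [insertEdge, hq]
    · have h' : ρ p ≠ ρ r := fun e => h (ρ.injective e)
      simp only [Option.map_none, swap_apply_left]
      rw [swap_apply_of_ne_of_ne (by simp) (by simpa using h), insertEdge_some_of_ne h',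
        insertEdge_some_of_eq hq.symm]
  · obtain ⟨y, hy⟩ : ∃ y, (ρ⁻¹ * τ⁻¹) z = y := ⟨_, rfl⟩
    have hz : z = τ (ρ y) := by simp [← hy]
    rw [Option.map_some, hy]
    by_cases h1 : y = p
    · subst h1
      simp only [swap_apply_right, swap_apply_left]
      rw [insertEdge_some_of_eq rfl, insertEdge_none, hq, hz]
    · rw [swap_apply_of_ne_of_ne (a := none) (b := some p) (by simp) (by simpa using h1)]
      have h3 : τ (ρ y) ≠ q := by rw [hq]; simpa using h1
      by_cases h2 : y = r
      · subst h2
        rw [swap_apply_right, insertEdge_none, insertEdge_some_of_ne h3, hz]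
      · rw [swap_apply_of_ne_of_ne (by simp) (by simpa using h2),
          insertEdge_some_of_ne (by simpa using h2), insertEdge_some_of_ne h3, hz]

variable {φ : Perm E} {φ' : Perm (Option E)} {r p : E}

/-- Faces that avoid both affected corners `r` and `p` survive unchanged. -/
theorem map_some_eq_rotate
    (hφ' : ∀ x, φ' x = swap none (some r) (swap none (some p) (x.map φ))) {l : List E}
    (hl : l.map φ = l.rotate 1) (hr : r ∉ l) (hp : p ∉ l) :
    (l.map some).map φ' = (l.map some).rotate 1 := by
  have h1 : (l.map some).map φ' =
      (l.map φ).map fun z => swap none (some r) (swap none (some p) (some z)) := by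
    simp [hφ']
  rw [h1, hl, ← List.map_rotate]
  refine List.map_congr_left fun z hz => ?_
  rw [List.mem_rotate] at hz
  have hzr : z ≠ r := fun e => hr (e ▸ hz)
  have hzp : z ≠ p := fun e => hp (e ▸ hz)
  rw [swap_apply_of_ne_of_ne (a := none) (b := some p) (by simp) (by simpa using hzp),
    swap_apply_of_ne_of_ne (by simp) (by simpa using hzr)]

variable [Fintype E]

/-- Splitting the orbit of `r`. -/
theorem IsDecomp.cut {l₁ l₂ t : List E} {N : Multiset (List E)}
    (h : IsDecomp φ ((r :: l₁ ++ l₂) ::ₘ N)) (hp : l₂ ++ [r] = p :: t)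
    (hφ' : ∀ x, φ' x = swap none (some r) (swap none (some p) (x.map φ))) :
    IsDecomp φ' ((r :: l₁).map some ::ₘ (none :: l₂.map some) ::ₘ N.map (List.map some)) := by
  have hr : r ∈ r :: l₁ ++ l₂ := by simp
  have hp' : p ∈ r :: l₁ ++ l₂ := by
    have : p ∈ l₂ ++ [r] := hp ▸ List.mem_cons_self
    simp only [List.mem_append, List.mem_cons] at this ⊢
    tauto
  have hnd : (r :: l₁ ++ l₂).Nodup := h.nodup_of_mem (Multiset.mem_cons_self _ _)
  have hm : (r :: l₁ ++ l₂).map φ = l₁ ++ p :: t := by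
    rw [h.map_eq _ (Multiset.mem_cons_self _ _), ← hp]
    simp
  rw [List.map_append] at hm
  have hlen : ((r :: l₁).map φ).length = (l₁ ++ [p]).length := by simp
  -- The old successor of the last entry of `r :: l₁` is `p`, the start of the remainder, or `r`
  -- itself when the remainder is empty. The transpositions redirect it to `r` and so close up the
  -- first piece.
  have hm1 : (r :: l₁).map φ = l₁ ++ [p] := by
    refine (List.append_inj (t₁ := l₂.map φ) (t₂ := t) ?_ hlen).1
    rw [hm]; simp
  have hm2 : l₂.map φ = t := by
    refine (List.append_inj (s₁ := (r :: l₁).map φ) (s₂ := l₁ ++ [p]) ?_ hlen).2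
    rw [hm]; simp
  have hfix : ∀ z, z ≠ r → z ≠ p →
      swap none (some r) (swap none (some p) (some z)) = some z := by
    intro z hzr hzp
    rw [swap_apply_of_ne_of_ne (a := none) (b := some p) (by simp) (by simpa using hzp),
      swap_apply_of_ne_of_ne (by simp) (by simpa using hzr)]
  have hmap : ∀ l : List E, (l.map some).map φ' =
      (l.map φ).map fun z => swap none (some r) (swap none (some p) (some z)) := by
    intro l; simp [hφ']
  refine ⟨?_, ?_, ?_⟩
  · intro k hk
    simp only [Multiset.mem_cons, Multiset.mem_map] at hk
    rcases hk with rfl | rfl | ⟨l, hl, rfl⟩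
    · simp
    · simp
    · simpa using h.ne_nil l (Multiset.mem_cons_of_mem hl)
  · intro k hk
    simp only [Multiset.mem_cons, Multiset.mem_map] at hk
    rcases hk with rfl | rfl | ⟨l, hl, rfl⟩
    · rw [hmap, hm1, List.map_append]
      have : l₁.map (fun z => swap none (some r) (swap none (some p) (some z))) =
          l₁.map some := by
        refine List.map_congr_left fun z hz => hfix z ?_ ?_
        · rintro rfl
          simp [hz] at hnd
        · rintro rfl
          rcases l₂ with _ | ⟨q, l₂⟩
          · simp only [List.nil_append, List.cons.injEq] at hp
            simp [hp.1, hz] at hnd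
          · simp only [List.cons_append, List.cons.injEq] at hp
            simp only [List.cons_append, List.nodup_cons, List.nodup_append] at hnd
            exact hnd.2.2.2 z hz z (by simp [hp.1]) rfl
      rw [this]
      simp
    · rw [List.map_cons, hmap, hm2, hφ']
      rcases l₂ with _ | ⟨q, l₂⟩
      · simp only [List.nil_append, List.cons.injEq] at hp
        obtain ⟨rfl, rfl⟩ := hp
        simp
      · simp only [List.cons_append, List.cons.injEq] at hp
        obtain ⟨rfl, rfl⟩ := hp
        simp only [List.cons_append, List.nodup_cons, List.nodup_append] at hnd
        have hqr : q ≠ r := by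
          rintro rfl
          simp at hnd
        have : l₂.map (fun z => swap none (some r) (swap none (some q) (some z))) =
            l₂.map some := by
          refine List.map_congr_left fun z hz => hfix z ?_ ?_
          · rintro rfl
            simp [hz] at hnd
          · rintro rfl
            simp [hz] at hnd
        rw [List.map_append, this]
        simp only [Option.map_none, swap_apply_left, List.map_cons, List.map_nil]
        rw [swap_apply_of_ne_of_ne (a := none) (b := some r) (x := some q) (by simp)
          (by simpa using hqr), swap_apply_of_ne_of_ne (a := none) (b := some q) (x := some r)
          (by simp) (by simpa using hqr.symm)]
        simp
    · exact map_some_eq_rotate hφ' (h.map_eq l (Multiset.mem_cons_of_mem hl))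
        (h.notMem_of_mem hl hr) (h.notMem_of_mem hl hp')
  · rw [univ_option_val, ← h.cover, Multiset.cons_bind, Multiset.cons_bind, Multiset.cons_bind,
      map_some_bind, Multiset.map_add, Multiset.map_coe, ← add_assoc, ← Multiset.cons_add]
    congr 1
    rw [Multiset.coe_add, Multiset.cons_coe, Multiset.coe_eq_coe, List.map_append]
    exact List.perm_middle

/-- Merging another orbit into the orbit of `r`. -/
theorem IsDecomp.join {l₁ l₂ : List E} {N : Multiset (List E)}
    (h : IsDecomp φ ((r :: l₁) ::ₘ (p :: l₂) ::ₘ N))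
    (hφ' : ∀ x, φ' x = swap none (some r) (swap none (some p) (x.map φ))) :
    IsDecomp φ' (((r :: l₁).map some ++ none :: (p :: l₂).map some) ::ₘ
      N.map (List.map some)) := by
  have h' : IsDecomp φ ((p :: l₂) ::ₘ (r :: l₁) ::ₘ N) := Multiset.cons_swap _ _ N ▸ h
  have hm1 : (r :: l₁).map φ = l₁ ++ [r] :=
    (h.map_eq _ (Multiset.mem_cons_self _ _)).trans (by simp)
  have hm2 : (p :: l₂).map φ = l₂ ++ [p] :=
    (h'.map_eq _ (Multiset.mem_cons_self _ _)).trans (by simp)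
  have hnd1 : r ∉ l₁ := (List.nodup_cons.1 (h.nodup_of_mem (Multiset.mem_cons_self _ _))).1
  have hnd2 : p ∉ l₂ := (List.nodup_cons.1 (h'.nodup_of_mem (Multiset.mem_cons_self _ _))).1
  have hr2 : r ∉ p :: l₂ := h.notMem_of_mem (Multiset.mem_cons_self _ _) List.mem_cons_self
  have hp1 : p ∉ r :: l₁ := h'.notMem_of_mem (Multiset.mem_cons_self _ _) List.mem_cons_self
  have hpr : p ≠ r := fun e => hp1 (e ▸ List.mem_cons_self)
  have hfix : ∀ z, z ≠ r → z ≠ p →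
      swap none (some r) (swap none (some p) (some z)) = some z := by
    intro z hzr hzp
    rw [swap_apply_of_ne_of_ne (a := none) (b := some p) (by simp) (by simpa using hzp),
      swap_apply_of_ne_of_ne (by simp) (by simpa using hzr)]
  have hmap : ∀ l : List E, (l.map some).map φ' =
      (l.map φ).map fun z => swap none (some r) (swap none (some p) (some z)) := by
    intro l; simp [hφ']
  refine ⟨?_, ?_, ?_⟩
  · intro k hk
    simp only [Multiset.mem_cons, Multiset.mem_map] at hk
    rcases hk with rfl | ⟨l, hl, rfl⟩
    · simp
    · simpa using h.ne_nil l (Multiset.mem_cons_of_mem (Multiset.mem_cons_of_mem hl))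
  · intro k hk
    simp only [Multiset.mem_cons, Multiset.mem_map] at hk
    rcases hk with rfl | ⟨l, hl, rfl⟩
    · have e1 : l₁.map (fun z => swap none (some r) (swap none (some p) (some z))) =
          l₁.map some :=
        List.map_congr_left fun z hz => hfix z (fun e => hnd1 (e ▸ hz))
          (fun e => hp1 (e ▸ List.mem_cons_of_mem _ hz))
      have e2 : l₂.map (fun z => swap none (some r) (swap none (some p) (some z))) =
          l₂.map some :=
        List.map_congr_left fun z hz => hfix z (fun e => hr2 (e ▸ List.mem_cons_of_mem _ hz))
          (fun e => hnd2 (e ▸ hz))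
      rw [List.map_append, List.map_cons (f := φ'), hmap, hmap, hm1, hm2, List.map_append,
        List.map_append, e1, e2, hφ']
      simp only [Option.map_none, swap_apply_left, List.map_cons, List.map_nil,
        swap_apply_right]
      rw [swap_apply_of_ne_of_ne (a := none) (b := some r) (x := some p) (by simp)
          (by simpa using hpr), swap_apply_of_ne_of_ne (a := none) (b := some p) (x := some r)
          (by simp) (by simpa using hpr.symm)]
      simp
    · exact map_some_eq_rotate hφ'
        (h.map_eq l (Multiset.mem_cons_of_mem (Multiset.mem_cons_of_mem hl)))
        (h.notMem_of_mem (Multiset.mem_cons_of_mem hl) List.mem_cons_self)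
        (h'.notMem_of_mem (Multiset.mem_cons_of_mem hl) List.mem_cons_self)
  · rw [univ_option_val, ← h.cover, Multiset.cons_bind, Multiset.cons_bind, Multiset.cons_bind,
      map_some_bind, Multiset.map_add, Multiset.map_add, Multiset.map_coe, Multiset.map_coe,
      ← add_assoc, ← Multiset.cons_add]
    congr 1
    rw [Multiset.coe_add, Multiset.cons_coe, Multiset.coe_eq_coe]
    exact List.perm_middle

end Insertion

end JoinCut

end

noncomputable section

namespace JoinCut

open MvPolynomial (pderiv)

/-! ### The cut and join operators on polynomials -/

theorem finite_pderiv_inl_ne_zero (p : MarkPoly) :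
    {R : List Dot | pderiv (Sum.inl R) p ≠ 0}.Finite :=
  (finite_pderiv_ne_zero p).preimage Sum.inl_injective.injOn

theorem finite_pderiv_inr_ne_zero (p : MarkPoly) :
    {S : Cycle Dot | pderiv (Sum.inr S) p ≠ 0}.Finite :=
  (finite_pderiv_ne_zero p).preimage Sum.inr_injective.injOn

theorem finite_support_mul_pderiv_inl (c : List Dot → MarkPoly) (p : MarkPoly) :
    (Function.support fun R => c R * pderiv (Sum.inl R) p).Finite :=
  (finite_pderiv_inl_ne_zero p).subset fun _ hR h0 => hR (by simp [h0])

theorem finite_support_mul_pderiv_inr (c : Cycle Dot → MarkPoly) (p : MarkPoly) :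
    (Function.support fun S => c S * pderiv (Sum.inr S) p).Finite :=
  (finite_pderiv_inr_ne_zero p).subset fun _ hS h0 => hS (by simp [h0])

/-- The commutator of two derivations is a derivation, and here it vanishes on every variable. -/
theorem pderiv_comm (v w : List Dot ⊕ Cycle Dot) (p : MarkPoly) :
    pderiv v (pderiv w p) = pderiv w (pderiv v p) := by
  have h : ⁅(pderiv v : Derivation ℚ MarkPoly MarkPoly),
      (pderiv w : Derivation ℚ MarkPoly MarkPoly)⁆ = 0 := by
    refine MvPolynomial.derivation_ext fun i => ?_
    classical
    rw [Derivation.commutator_apply, MvPolynomial.pderiv_X, MvPolynomial.pderiv_X]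
    simp only [Pi.single_apply]
    split_ifs <;> simp
  have h2 := DFunLike.congr_fun h p
  rw [Derivation.commutator_apply, Derivation.zero_apply] at h2
  exact sub_eq_zero.1 h2

/-- The first order operator with coefficient `c S` at `∂/∂f_(S)`. -/
def faceOp (c : Cycle Dot → MarkPoly) (p : MarkPoly) : MarkPoly :=
  ∑ᶠ S : Cycle Dot, c S * pderiv (Sum.inr S) p

theorem faceOp_add (c : Cycle Dot → MarkPoly) (p q : MarkPoly) :
    faceOp c (p + q) = faceOp c p + faceOp c q := by
  rw [faceOp, faceOp, faceOp, ← finsum_add_distrib (finite_support_mul_pderiv_inr c p)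
    (finite_support_mul_pderiv_inr c q)]
  simp only [map_add, mul_add]

theorem faceOp_smul (c : Cycle Dot → MarkPoly) (a : ℚ) (p : MarkPoly) :
    faceOp c (a • p) = a • faceOp c p := by
  rw [faceOp, faceOp, smul_finsum]
  simp only [Derivation.map_smul, mul_smul_comm]

theorem faceOp_mul (c : Cycle Dot → MarkPoly) (p q : MarkPoly) :
    faceOp c (p * q) = p * faceOp c q + faceOp c p * q := by
  rw [faceOp, faceOp, faceOp, mul_finsum, finsum_mul, ← finsum_add_distrib]
  · refine finsum_congr fun S => ?_
    rw [Derivation.leibniz, smul_eq_mul, smul_eq_mul]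
    ring
  · exact (finite_support_mul_pderiv_inr c q).subset fun S hS h0 => hS (by simp [h0])
  · exact (finite_support_mul_pderiv_inr c p).subset fun S hS h0 => hS (by simp [h0])

theorem faceOp_one (c : Cycle Dot → MarkPoly) : faceOp c 1 = 0 := by
  simp [faceOp]

theorem faceOp_f (c : Cycle Dot → MarkPoly) (S : Cycle Dot) : faceOp c (f S) = c S := by
  classical
  rw [faceOp, finsum_eq_single _ S]
  · simp [f]
  · intro S' h
    rw [f, MvPolynomial.pderiv_X_of_ne (by simpa using h.symm), mul_zero]

/-- Leibniz rule: the operator picks each non-root face in turn, with multiplicity, and replaces its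
factor. Combinatorially this is the choice of the face to be joined to the root face. -/
theorem faceOp_prod {ι : Type} [DecidableEq ι] (c : Cycle Dot → MarkPoly) (w : ι → Cycle Dot)
    (N : Multiset ι) :
    faceOp c (N.map fun l => f (w l)).prod =
      (N.map fun l => c (w l) * ((N.erase l).map fun l => f (w l)).prod).sum := by
  induction N using Multiset.induction with
  | empty => simp [faceOp_one]
  | cons a N ih =>
    rw [Multiset.map_cons, Multiset.prod_cons, faceOp_mul, faceOp_f, ih, Multiset.map_cons,
      Multiset.sum_cons, Multiset.erase_cons_head, add_comm, ← Multiset.sum_map_mul_left]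
    congr 2
    refine Multiset.map_congr rfl fun l hl => ?_
    rw [Multiset.erase_cons_tail_of_mem hl, Multiset.map_cons, Multiset.prod_cons]
    ring

theorem pderiv_inl_prod {ι : Type} (w : ι → Cycle Dot) (N : Multiset ι) (R : List Dot) :
    pderiv (Sum.inl R) (N.map fun l => f (w l)).prod = 0 := by
  induction N using Multiset.induction with
  | empty => simp
  | cons a N ih =>
    rw [Multiset.map_cons, Multiset.prod_cons, Derivation.leibniz, ih, f,
      MvPolynomial.pderiv_X_of_ne (by simp)]
    simp

theorem cutPoly_add (p q : MarkPoly) : cutPoly (p + q) = cutPoly p + cutPoly q := by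
  rw [cutPoly, cutPoly, cutPoly, ← finsum_add_distrib (finite_support_mul_pderiv_inl _ p)
    (finite_support_mul_pderiv_inl _ q)]
  simp only [map_add, mul_add]

theorem cutPoly_smul (a : ℚ) (p : MarkPoly) : cutPoly (a • p) = a • cutPoly p := by
  rw [cutPoly, cutPoly, smul_finsum]
  simp only [Derivation.map_smul, mul_smul_comm]

/-- Face monomials are linear in the variables `g`, so only one summand of C' survives. -/
theorem cutPoly_g_mul {P : MarkPoly} (hP : ∀ R, pderiv (Sum.inl R) P = 0) (R : List Dot) :
    cutPoly (g R * P) = (∑ i ∈ Finset.Icc 2 R.length,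
        g (R.take i) * f ((R.take 1 ++ R.drop i : List Dot) : Cycle Dot)) * P := by
  classical
  rw [cutPoly, finsum_eq_single _ R]
  · rw [Derivation.leibniz, hP, g, MvPolynomial.pderiv_X_self]
    simp
  · intro R' h
    rw [Derivation.leibniz, hP, g, MvPolynomial.pderiv_X_of_ne (by simpa using h.symm)]
    simp

/-- The coefficient `∑_{T ∈ (S)} g_{R R_1 T}` of `J'`. -/
def joinCoeff (R : List Dot) (S : Cycle Dot) : MarkPoly :=
  (S.lists.map fun T => g (R ++ R.take 1 ++ T)).sum

/-- Differentiating by `g_R` first leaves a derivation in the variables `f_(S)`, to which the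
Leibniz rule applies. -/
theorem joinPoly_eq (p : MarkPoly) : joinPoly p =
    ∑ᶠ (R : List Dot) (_ : R ≠ []), faceOp (joinCoeff R) (pderiv (Sum.inl R) p) := by
  refine finsum_congr fun R => finsum_congr fun _ => finsum_congr fun S => ?_
  rw [pderiv_comm, joinCoeff]

theorem faceOp_zero (c : Cycle Dot → MarkPoly) : faceOp c 0 = 0 := by
  simp [faceOp]

theorem joinPoly_add (p q : MarkPoly) : joinPoly (p + q) = joinPoly p + joinPoly q := by
  have h : ∀ p : MarkPoly, ({R : List Dot | R ≠ []} ∩ Function.support fun R =>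
      faceOp (joinCoeff R) (pderiv (Sum.inl R) p)).Finite := fun p =>
    (finite_pderiv_inl_ne_zero p).subset fun R hR h0 => hR.2 (by simp only [h0, faceOp_zero])
  rw [joinPoly_eq, joinPoly_eq, joinPoly_eq]
  refine Eq.trans ?_ (finsum_mem_add_distrib' (h p) (h q))
  simp only [map_add, faceOp_add]
  rfl

theorem joinPoly_smul (a : ℚ) (p : MarkPoly) : joinPoly (a • p) = a • joinPoly p := by
  rw [joinPoly_eq, joinPoly_eq, smul_finsum]
  refine finsum_congr fun R => ?_
  rw [smul_finsum]
  simp only [Derivation.map_smul, faceOp_smul]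

theorem joinPoly_g_mul {P : MarkPoly} (hP : ∀ R, pderiv (Sum.inl R) P = 0) {R : List Dot}
    (hR : R ≠ []) : joinPoly (g R * P) = faceOp (joinCoeff R) P := by
  classical
  rw [joinPoly_eq, finsum_eq_single _ R]
  · rw [Derivation.leibniz, hP, g, MvPolynomial.pderiv_X_self]
    simp [hR]
  · intro R' h
    rw [Derivation.leibniz, hP, g, MvPolynomial.pderiv_X_of_ne (by simpa using h.symm)]
    simp [faceOp_zero]

/-- `C'` as a linear map. -/
def cutLin : MarkPoly →ₗ[ℚ] MarkPoly where
  toFun := cutPoly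
  map_add' := cutPoly_add
  map_smul' := cutPoly_smul

/-- `J'` as a linear map. -/
def joinLin : MarkPoly →ₗ[ℚ] MarkPoly where
  toFun := joinPoly
  map_add' := joinPoly_add
  map_smul' := joinPoly_smul

end JoinCut

end

noncomputable section

namespace JoinCut

open Equiv Equiv.Perm
open MvPolynomial (pderiv)

/-! ### Summing over the places where an edge can be inserted -/

theorem sum_range_succ_eq_add_sum_Icc {M : Type} [AddCommMonoid M] (H : ℕ → M) (k : ℕ) :
    ∑ i ∈ Finset.range (k + 1), H (i + 1) = H 1 + ∑ i ∈ Finset.Icc 2 (k + 1), H i := by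
  induction k with
  | zero => simp
  | succ k ih =>
    rw [Finset.sum_range_succ, ih, Finset.sum_Icc_succ_top (show 2 ≤ k + 1 + 1 by omega), add_assoc]

/-- Choosing an entry of a cyclic list amounts to choosing the rotation that starts there. With
repeated symbols, distinct corners may give equal words, hence the multiplicities among cyclic
shifts in J'. -/
theorem sum_map_eq_sum_cyclicPermutations {α M : Type} [AddCommMonoid M] (l : List α)
    (hl : l ≠ []) (h : α → M) (H : List α → M)
    (hH : ∀ p t, l ~r (p :: t) → h p = H (p :: t)) :
    (l.map h).sum = (l.cyclicPermutations.map H).sum := by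
  congr 1
  apply List.ext_getElem
  · simp [List.length_cyclicPermutations_of_ne_nil l hl]
  · intro i h1 h2
    have hi : i < l.length := by simpa using h1
    rw [List.getElem_map, List.getElem_map, List.getElem_cyclicPermutations]
    have hr : l.rotate i = l[i] :: (l.drop (i + 1) ++ l.take i) := by
      rw [List.rotate_eq_drop_append_take hi.le, List.drop_eq_getElem_cons hi, List.cons_append]
    rw [hr]
    exact hH _ _ ⟨i, hr⟩

theorem cyclicPermutations_map_map {α β : Type} (m : α → β) (l : List α) :
    (l.map m).cyclicPermutations = l.cyclicPermutations.map (List.map m) := by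
  rcases eq_or_ne l [] with rfl | hl
  · rfl
  apply List.ext_getElem
  · rw [List.length_cyclicPermutations_of_ne_nil _ (by simpa using hl), List.length_map,
      List.length_map, List.length_cyclicPermutations_of_ne_nil _ hl]
  · intro i h1 h2
    simp only [List.getElem_map, List.getElem_cyclicPermutations, List.map_rotate]

variable {E : Type} [Fintype E] [DecidableEq E]

/-- The root face keeps its initial segment; the rest, preceded by the corner of the new edge,
becomes a separate face. -/
theorem faceMonomial_cut {φ : Perm E} {φ' : Perm (Option E)} {r p : E} {l₁ l₂ t : List E}
    {N : Multiset (List E)} (h : IsDecomp φ ((r :: l₁ ++ l₂) ::ₘ N)) (hp : l₂ ++ [r] = p :: t)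
    (hφ' : ∀ x, φ' x = swap none (some r) (swap none (some p) (x.map φ)))
    {mark : E → Dot} {mark' : Option E → Dot} (hm : ∀ z, mark' (some z) = mark z) :
    faceMonomial φ' mark' (some r) = g ((r :: l₁).map mark) *
      (f ((mark' none :: l₂.map mark : List Dot) : Cycle Dot) *
        (N.map fun l => f (l.map mark : Cycle Dot)).prod) := by
  have h2 : IsDecomp φ' ((some r :: l₁.map some) ::ₘ
      (none :: l₂.map some) ::ₘ N.map (List.map some)) := h.cut hp hφ'
  rw [h2.faceMonomial_eq mark']
  simp [Function.comp_def, hm]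

/-- The boundary walk runs around the old root face, passes the new corner, and then runs around the
other face from `p`. -/
theorem faceMonomial_join {φ : Perm E} {φ' : Perm (Option E)} {r p : E} {l₁ l₂ : List E}
    {N : Multiset (List E)} (h : IsDecomp φ ((r :: l₁) ::ₘ (p :: l₂) ::ₘ N))
    (hφ' : ∀ x, φ' x = swap none (some r) (swap none (some p) (x.map φ)))
    {mark : E → Dot} {mark' : Option E → Dot} (hm : ∀ z, mark' (some z) = mark z) :
    faceMonomial φ' mark' (some r) = g ((r :: l₁).map mark ++ mark' none :: (p :: l₂).map mark) *
      (N.map fun l => f (l.map mark : Cycle Dot)).prod := by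
  have h2 : IsDecomp φ' ((some r :: (l₁.map some ++ none :: (p :: l₂).map some)) ::ₘ
      N.map (List.map some)) := h.join hφ'
  rw [h2.faceMonomial_eq mark']
  simp [Function.comp_def, hm]

/-- Inserting an edge into the root corner, in all ways but one: every face is cut or joined. -/
theorem sum_faceMonomial_insert (φ : Perm E) (mark : E → Dot) (mark' : Option E → Dot) (r : E)
    (hm : ∀ z, mark' (some z) = mark z) (hm0 : mark' none = mark r)
    (Φ : E → Perm (Option E))
    (hΦ : ∀ p x, Φ p x = swap none (some r) (swap none (some p) (x.map φ))) (w : ℕ → ℚ) :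
    ∑ p ∈ Finset.univ.erase (φ r),
        w (Nat.card (Face (Φ p))) • faceMonomial (Φ p) mark' (some r) =
      w (Nat.card (Face φ) + 1) • cutPoly (faceMonomial φ mark r) +
        w (Nat.card (Face φ) - 1) • joinPoly (faceMonomial φ mark r) := by
  obtain ⟨t, N, h⟩ := exists_isDecomp φ r
  have hc : Nat.card (Face φ) = Multiset.card N + 1 := by rw [h.card_face]; simp
  set hh : E → MarkPoly := fun p =>
    w (Nat.card (Face (Φ p))) • faceMonomial (Φ p) mark' (some r) with hhh
  set P : MarkPoly := (N.map fun l => f (l.map mark : Cycle Dot)).prod with hP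
  set R : List Dot := (r :: t).map mark with hR
  set H : ℕ → MarkPoly := fun i => w (Nat.card (Face φ) + 1) •
    (g (R.take i) * f ((R.take 1 ++ R.drop i : List Dot) : Cycle Dot) * P) with hH
  -- The root orbit is listed with `r` last: the choice `p = r` leaves the whole root word in place
  -- and splits off a face with one corner. The shift by one arises because `r` itself belongs to
  -- the part that is kept.
  have hcut : ∀ (i : ℕ) (hi : i < (t ++ [r]).length), hh ((t ++ [r])[i]) = H (i + 1) := by
    intro i hi
    have hi' : i ≤ t.length := by simpa [Nat.lt_succ_iff] using hi
    have hsplit : r :: t = r :: t.take i ++ t.drop i := by simp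
    have hp : t.drop i ++ [r] = (t ++ [r])[i] :: (t ++ [r]).drop (i + 1) := by
      rw [← List.drop_eq_getElem_cons hi, List.drop_append_of_le_length hi']
    have h' : IsDecomp φ ((r :: t.take i ++ t.drop i) ::ₘ N) := hsplit ▸ h
    have hcard := (h'.cut hp (hΦ _)).card_face
    simp only [hhh, hH]
    rw [faceMonomial_cut h' hp (hΦ _) hm, hcard, hm0, hc, hR]
    simp [hP, List.map_take, List.map_drop, mul_assoc]
  have hjoin : ∀ l ∈ N, ∀ p t', l ~r (p :: t') → hh p = w (Nat.card (Face φ) - 1) •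
      (g (R ++ R.take 1 ++ (p :: t').map mark) *
        ((N.erase l).map fun l => f (l.map mark : Cycle Dot)).prod) := by
    intro l hl p t' hrot
    have h' : IsDecomp φ ((p :: t') ::ₘ (r :: t) ::ₘ N.erase l) := by
      refine IsDecomp.rotate ?_ hrot
      rw [Multiset.cons_swap, Multiset.cons_erase hl]
      exact h
    rw [Multiset.cons_swap] at h'
    have hcard := (h'.join (hΦ p)).card_face
    simp only [hhh]
    rw [faceMonomial_join h' (hΦ _) hm, hcard, hm0, hc, hR]
    have hN : Multiset.card (N.erase l) + 1 = Multiset.card N := Multiset.card_erase_add_one hl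
    simp [hN]
  have hN : (N.map fun l => (l.map hh).sum).sum =
      w (Nat.card (Face φ) - 1) • joinPoly (faceMonomial φ mark r) := by
    rw [h.faceMonomial_eq mark, joinPoly_g_mul (pderiv_inl_prod _ _) (by simp), faceOp_prod,
      Multiset.smul_sum, Multiset.map_map]
    congr 1
    refine Multiset.map_congr rfl fun l hl => ?_
    rw [sum_map_eq_sum_cyclicPermutations l (h.ne_nil l (Multiset.mem_cons_of_mem hl)) hh
      (fun l' => w (Nat.card (Face φ) - 1) • (g (R ++ R.take 1 ++ l'.map mark) *
        ((N.erase l).map fun l => f (l.map mark : Cycle Dot)).prod)) (hjoin l hl)]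
    rw [Function.comp_apply, joinCoeff, Cycle.lists_coe, cyclicPermutations_map_map,
      Multiset.map_coe, Multiset.sum_coe, List.map_map, ← hR, ← List.sum_map_mul_right,
      List.smul_sum, List.map_map]
    rfl
  -- First all insertions are counted, including `p = φ r`; that one is the cut after a single
  -- symbol and is cancelled below.
  have hall : hh (φ r) + ∑ p ∈ Finset.univ.erase (φ r), hh p =
      H 1 + w (Nat.card (Face φ) + 1) • cutPoly (faceMonomial φ mark r) +
        w (Nat.card (Face φ) - 1) • joinPoly (faceMonomial φ mark r) := by
    rw [Finset.add_sum_erase _ _ (Finset.mem_univ _), Finset.sum_eq_multiset_sum, ← h.cover,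
      Multiset.map_bind, Multiset.sum_bind, Multiset.map_cons, Multiset.sum_cons]
    simp only [Multiset.map_coe, Multiset.sum_coe]
    rw [hN]
    congr 1
    have hperm : ((r :: t).map hh).sum = ((t ++ [r]).map hh).sum :=
      ((List.perm_append_singleton r t).symm.map hh).sum_eq
    have hlen : R.length = t.length + 1 := by simp [hR]
    rw [hperm, ← Fin.sum_univ_fun_getElem, h.faceMonomial_eq mark,
      cutPoly_g_mul (pderiv_inl_prod _ _), ← hR, ← hP, hlen, Finset.sum_mul, Finset.smul_sum,
      ← sum_range_succ_eq_add_sum_Icc H, ← Fin.sum_univ_eq_sum_range (fun i => H (i + 1))]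
    refine Fintype.sum_equiv (finCongr (by simp)) _ _ fun i => ?_
    exact hcut i i.2
  have h1 : hh (φ r) = H 1 := by
    have hmap : (r :: t).map φ = t ++ [r] := by
      simpa using h.map_eq _ (Multiset.mem_cons_self _ _)
    have : φ r = (t ++ [r])[0]'(by simp) := by
      simp only [← hmap]; rfl
    rw [this]
    exact hcut 0 (by simp)
  rw [h1, add_assoc] at hall
  exact add_left_cancel hall

/-! ### Full cycles -/

/-- `σ` permutes all elements in a single cycle. -/
def IsFull {E : Type} (σ : Perm E) : Prop := ∀ e e', σ.SameCycle e e'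

/-- The number of steps under `ρ` from `r` to `e`. -/
def pos {E : Type} (ρ : Perm E) (r e : E) : ℕ := sInf {k : ℕ | (ρ ^ k) r = e}

/-- The marks of the corners: black from `r` to `s`, white from `s` to `r`. -/
def markOf {E : Type} (ρ : Perm E) (r s e : E) : Dot :=
  if pos ρ r e < pos ρ r s then Dot.black else Dot.white

/-- The map need not be injective or commute with the permutations. This permits both the inclusion
of `E` into `Option E` and the collapse of the new edge onto its successor. -/
theorem sameCycle_of_semiconj {E E' : Type} [Finite E] {φ : Perm E} {ψ : Perm E'} (π : E → E')
    (hπ : ∀ x, ψ.SameCycle (π x) (π (φ x))) {x y : E} (h : φ.SameCycle x y) :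
    ψ.SameCycle (π x) (π y) := by
  obtain ⟨i, -, rfl⟩ := h.exists_pow_eq'
  clear h
  induction i with
  | zero => exact SameCycle.refl _ _
  | succ k ih =>
    rw [pow_succ', mul_apply]
    exact ih.trans (hπ _)

theorem pos_self {E : Type} (ρ : Perm E) (r : E) : pos ρ r r = 0 :=
  Nat.sInf_eq_zero.2 (Or.inl rfl)

namespace IsFull

section

variable {E : Type} [Fintype E] {ρ : Perm E}

theorem minimalPeriod_eq (hρ : IsFull ρ) (r : E) :
    Function.minimalPeriod ρ r = Fintype.card E := by
  classical
  have h1 : (orbitList ρ r).toFinset = Finset.univ := by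
    ext e
    simpa [mem_orbitList] using hρ r e
  rw [← Finset.card_univ, ← h1, List.toFinset_card_of_nodup (orbitList_nodup ρ r), orbitList,
    List.length_map, List.length_range]

theorem pow_card_apply (hρ : IsFull ρ) (r : E) : (ρ ^ Fintype.card E) r = r := by
  rw [← hρ.minimalPeriod_eq r, ← iterate_eq_pow]
  exact Function.iterate_minimalPeriod

theorem pow_injOn (hρ : IsFull ρ) (r : E) {i j : ℕ} (hi : i < Fintype.card E)
    (hj : j < Fintype.card E) (h : (ρ ^ i) r = (ρ ^ j) r) : i = j := by
  rw [← hρ.minimalPeriod_eq r] at hi hj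
  rw [← iterate_eq_pow, ← iterate_eq_pow] at h
  exact Function.iterate_injOn_Iio_minimalPeriod hi hj h

theorem exists_pow_eq (hρ : IsFull ρ) (r e : E) : ∃ k < Fintype.card E, (ρ ^ k) r = e := by
  have := mem_orbitList.2 (hρ r e)
  rw [orbitList, List.mem_map, hρ.minimalPeriod_eq r] at this
  obtain ⟨k, hk, h⟩ := this
  exact ⟨k, List.mem_range.1 hk, h⟩

theorem pow_pos_apply (hρ : IsFull ρ) (r e : E) : (ρ ^ pos ρ r e) r = e := by
  obtain ⟨k, -, hk⟩ := hρ.exists_pow_eq r e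
  exact Nat.sInf_mem (s := {k : ℕ | (ρ ^ k) r = e}) ⟨k, hk⟩

theorem pos_lt (hρ : IsFull ρ) (r e : E) : pos ρ r e < Fintype.card E := by
  obtain ⟨k, hk, h⟩ := hρ.exists_pow_eq r e
  exact (Nat.sInf_le h).trans_lt hk

theorem pos_eq (hρ : IsFull ρ) {r e : E} {k : ℕ} (hk : k < Fintype.card E)
    (h : (ρ ^ k) r = e) : pos ρ r e = k :=
  hρ.pow_injOn r (hρ.pos_lt r e) hk ((hρ.pow_pos_apply r e).trans h.symm)

theorem pos_injective (hρ : IsFull ρ) (r : E) : Function.Injective (pos ρ r) := by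
  intro e e' h
  rw [← hρ.pow_pos_apply r e, ← hρ.pow_pos_apply r e', h]

theorem pos_pos (hρ : IsFull ρ) {r e : E} (h : e ≠ r) : 0 < pos ρ r e := by
  refine Nat.pos_of_ne_zero fun h0 => h (hρ.pos_injective r ?_)
  rw [h0, pos_self]

/-- Two full cycles of the same length, with base points, are conjugate. -/
theorem exists_equiv (hρ : IsFull ρ) {E' : Type} [Fintype E'] {ρ' : Perm E'} (hρ' : IsFull ρ')
    (hc : Fintype.card E = Fintype.card E') (r : E) (r' : E') :
    ∃ π : E ≃ E', (∀ e, π (ρ e) = ρ' (π e)) ∧ π r = r' := by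
  have hinj : Function.Injective fun e => (ρ' ^ pos ρ r e) r' := fun e e' h =>
    hρ.pos_injective r
      (hρ'.pow_injOn r' (hc ▸ hρ.pos_lt r e) (hc ▸ hρ.pos_lt r e') h)
  refine ⟨Equiv.ofBijective _ ((Fintype.bijective_iff_injective_and_card _).2 ⟨hinj, hc⟩),
    fun e => ?_, ?_⟩
  · change (ρ' ^ pos ρ r (ρ e)) r' = ρ' ((ρ' ^ pos ρ r e) r')
    have h1 : (ρ ^ (pos ρ r e + 1)) r = ρ e := by
      rw [pow_succ', mul_apply, hρ.pow_pos_apply]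
    rw [← mul_apply, ← pow_succ']
    rcases Nat.lt_or_ge (pos ρ r e + 1) (Fintype.card E) with h | h
    · rw [hρ.pos_eq h h1]
    · have h2 : pos ρ r e + 1 = Fintype.card E := le_antisymm (hρ.pos_lt r e) h
      rw [h2, hρ.pow_card_apply] at h1
      rw [← h1, pos_self, h2, hc, hρ'.pow_card_apply]
      rfl
  · change (ρ' ^ pos ρ r r) r' = r'
    rw [pos_self]
    rfl

/-- Rigidity of rooted dipoles: every edge is reached from the root by iterating `ρ`. -/
theorem eq_refl_of_commute (hρ : IsFull ρ) {π : E ≃ E} (h : ∀ e, π (ρ e) = ρ (π e)) {r : E}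
    (hr : π r = r) (e : E) : π e = e := by
  rw [← hρ.pow_pos_apply r e, ← LabelledBirooted.pow_congr π h, hr]

theorem apply_eq_iff_pos (hρ : IsFull ρ) {r s : E} :
    ρ s = r ↔ pos ρ r s + 1 = Fintype.card E := by
  have h1 : (ρ ^ (pos ρ r s + 1)) r = ρ s := by
    rw [pow_succ', mul_apply, hρ.pow_pos_apply]
  constructor
  · intro h
    refine le_antisymm (hρ.pos_lt r s) (le_of_not_gt fun hlt => ?_)
    have := hρ.pos_eq hlt (h1.trans h)
    rw [pos_self] at this
    omega
  · intro h
    rw [← h1, h, hρ.pow_card_apply]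

theorem card_pos_between (hρ : IsFull ρ) (r : E) {i j : ℕ} (hj : j ≤ Fintype.card E) :
    Nat.card {e // i < pos ρ r e ∧ pos ρ r e < j} = j - i - 1 := by
  classical
  rw [Nat.card_eq_fintype_card, Fintype.card_subtype,
    ← Finset.card_image_of_injective _ (hρ.pos_injective r), ← Nat.card_Ioo]
  congr 1
  ext k
  simp only [Finset.mem_image, Finset.mem_filter, Finset.mem_univ, true_and, Finset.mem_Ioo]
  constructor
  · rintro ⟨e, he, rfl⟩
    exact he
  · intro hk
    have := hρ.pos_eq (r := r) (hk.2.trans_le hj) rfl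
    exact ⟨(ρ ^ k) r, this.symm ▸ hk, this⟩

theorem permCongr {E E' : Type} {ρ : Perm E} (hρ : IsFull ρ) (ε : E ≃ E') : IsFull (ε.permCongr ρ) := by
  intro e e'
  have := (sameCycle_congr (φ := ρ) (φ' := ε.permCongr ρ) ε (fun e => by simp) (ε.symm e)
    (ε.symm e')).2 (hρ _ _)
  simpa using this

end

section

variable {E : Type} [Fintype E] [DecidableEq E] {ρ : Perm E}

/-- Insertion only lengthens the cycle through `q`; conversely, collapsing `none` onto `q` undoes
it. -/
theorem insertEdge_iff {q : E} : IsFull (insertEdge ρ q) ↔ IsFull ρ := by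
  have step : ∀ z, (insertEdge ρ q).SameCycle (some z) (some (ρ z)) := by
    intro z
    by_cases h : ρ z = q
    · refine ⟨2, ?_⟩
      rw [zpow_ofNat, pow_two, mul_apply, insertEdge_some_of_eq h, insertEdge_none, h]
    · exact ⟨1, by rw [zpow_one, insertEdge_some_of_ne h]⟩
  constructor
  · intro h e e'
    refine sameCycle_of_semiconj (fun x : Option E => x.getD q) ?_ (h (some e) (some e'))
    rintro (_ | z)
    · rw [insertEdge_none]
      exact SameCycle.refl _ _
    · by_cases hz : ρ z = q
      · rw [insertEdge_some_of_eq hz]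
        exact ⟨1, by simpa using hz⟩
      · rw [insertEdge_some_of_ne hz]
        exact ⟨1, by simp⟩
  · intro h
    have hsome : ∀ e e', (insertEdge ρ q).SameCycle (some e) (some e') := fun e e' =>
      sameCycle_of_semiconj some step (h e e')
    have hnone : ∀ e, (insertEdge ρ q).SameCycle none (some e) := fun e =>
      SameCycle.trans ⟨1, by rw [zpow_one, insertEdge_none]⟩ (hsome q e)
    rintro (_ | e) (_ | e')
    · exact SameCycle.refl _ _
    · exact hnone e'
    · exact (hnone e).symm
    · exact hsome e e'

theorem pos_insertEdge_none (hρ : IsFull ρ) (r : E) :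
    pos (insertEdge ρ (ρ r)) (some r) none = 1 := by
  refine (insertEdge_iff.2 hρ).pos_eq ?_ ?_
  · rw [Fintype.card_option]
    have := Fintype.card_pos_iff.2 ⟨r⟩
    omega
  · rw [pow_one, insertEdge_some_of_eq rfl]

/-- The new edge takes position 1 and pushes every other non-root edge one step further. -/
theorem pos_insertEdge_some (hρ : IsFull ρ) {r z : E} (hz : z ≠ r) :
    pos (insertEdge ρ (ρ r)) (some r) (some z) = pos ρ r z + 1 := by
  have key : ∀ k, k + 1 < Fintype.card E →
      (insertEdge ρ (ρ r) ^ (k + 1 + 1)) (some r) = some ((ρ ^ (k + 1)) r) := by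
    intro k
    induction k with
    | zero =>
      intro _
      rw [pow_succ', pow_succ', pow_zero, mul_apply, mul_apply, one_apply,
        insertEdge_some_of_eq rfl, insertEdge_none, zero_add, pow_one]
    | succ k ih =>
      intro hk
      rw [pow_succ', mul_apply, ih (by omega), insertEdge_some_of_ne, ← mul_apply, ← pow_succ']
      intro h
      have := hρ.pow_injOn r (i := k + 1) (j := 0) (by omega) (by omega) (ρ.injective h)
      omega
  obtain ⟨k, hk⟩ := Nat.exists_eq_succ_of_ne_zero (hρ.pos_pos hz).ne'
  have hlt := hρ.pos_lt r z
  refine (insertEdge_iff.2 hρ).pos_eq ?_ ?_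
  · rw [Fintype.card_option]
    omega
  · rw [hk, Nat.succ_eq_add_one, key k (by omega), ← Nat.succ_eq_add_one, ← hk,
      hρ.pow_pos_apply]

theorem markOf_insertEdge_some (hρ : IsFull ρ) {r s : E} (hs : s ≠ r) (z : E) :
    markOf (insertEdge ρ (ρ r)) (some r) (some s) (some z) = markOf ρ r s z := by
  rw [markOf, markOf, hρ.pos_insertEdge_some hs]
  rcases eq_or_ne z r with rfl | hz
  · have := hρ.pos_pos hs
    simp [pos_self, this]
  · simp [hρ.pos_insertEdge_some hz]

/-- The new edge divides the root corner in two, and both parts lie in the same region. This is the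
source of the repeated symbol `R_1` in C' and J'. -/
theorem markOf_insertEdge_none (hρ : IsFull ρ) {r s : E} (hs : s ≠ r) :
    markOf (insertEdge ρ (ρ r)) (some r) (some s) none = markOf ρ r s r := by
  have := hρ.pos_pos hs
  rw [markOf, markOf, hρ.pos_insertEdge_some hs, hρ.pos_insertEdge_none, pos_self]
  simp [this]

/-- When the new edge is itself the secondary edge, Region 1 consists of the root corner alone. -/
theorem markOf_insertEdge_secondary (hρ : IsFull ρ) (r : E) (x : Option E) :
    markOf (insertEdge ρ (ρ r)) (some r) none x =
      if x = some r then Dot.black else Dot.white := by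
  rw [markOf, hρ.pos_insertEdge_none]
  rcases x with _ | z
  · simp [hρ.pos_insertEdge_none]
  · rcases eq_or_ne z r with rfl | hz
    · simp [pos_self]
    · simp [hρ.pos_insertEdge_some hz, hz]

end

end IsFull

/-! ### Dipoles without `c`- and `d`-edges -/

namespace LabelledBirooted

variable (D : LabelledBirooted)

/-- Region 4 must be empty, so the secondary edge comes last before the root at the other vertex.
Otherwise the edge in that last place would be a c- or d-edge. -/
theorem gamma_eq_zero_and_delta_eq_zero_iff :
    D.gamma = 0 ∧ D.delta = 0 ↔ D.otherRot D.secondary = D.root := by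
  have hρ : IsFull D.rootRot := D.rootRot_full
  have hτ : IsFull D.otherRot := D.otherRot_full
  have hlt : ∀ e, D.otherPos e < D.n := fun e =>
    (hτ.pos_lt D.root e).trans_eq (Fintype.card_fin _)
  rw [hτ.apply_eq_iff_pos, Fintype.card_fin]
  change _ ↔ D.otherPos D.secondary + 1 = D.n
  constructor
  · rintro ⟨hc, hd⟩
    have hc' := (Nat.card_eq_zero.1 hc).resolve_right (fun h => h.not_finite inferInstance)
    have hd' := (Nat.card_eq_zero.1 hd).resolve_right (fun h => h.not_finite inferInstance)
    have hpos : D.n ≠ 0 := fun h => (h ▸ D.root : Fin 0).elim0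
    obtain ⟨e, he⟩ : ∃ e, D.otherPos e = D.n - 1 :=
      ⟨(D.otherRot ^ (D.n - 1)) D.root, hτ.pos_eq (by rw [Fintype.card_fin]; omega) rfl⟩
    have h2 := hlt D.secondary
    by_contra hne
    have hs : e ≠ D.secondary := by
      rintro rfl
      omega
    have h3 : D.rootPos e ≠ D.rootPos D.secondary := fun h => hs (D.rootPos_injective h)
    have h4 : 0 < D.rootPos e := by
      refine hρ.pos_pos ?_
      rintro rfl
      have : D.otherPos D.root = 0 := pos_self _ _
      have h5 : 0 < D.otherPos D.secondary := hτ.pos_pos D.secondary_ne_root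
      omega
    rcases Nat.lt_or_gt_of_ne h3 with h | h
    · exact hd'.false ⟨e, ⟨h4, h⟩, show D.otherPos D.secondary < _ by omega⟩
    · exact hc'.false ⟨e, h, show D.otherPos D.secondary < _ by omega⟩
  · intro h
    have h4 : ∀ e, ¬ D.InRegion4 e := fun e he => by
      have := hlt e
      change D.otherPos D.secondary < D.otherPos e at he
      omega
    constructor
    · exact Nat.card_eq_zero.2 (Or.inl ⟨fun e => h4 _ e.2.2⟩)
    · exact Nat.card_eq_zero.2 (Or.inl ⟨fun e => h4 _ e.2.2⟩)

variable {D}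

theorem inRegion3_of_ne (h : D.otherRot D.secondary = D.root) {e : Fin D.n} (h1 : e ≠ D.root)
    (h2 : e ≠ D.secondary) : D.InRegion3 e := by
  have hτ : IsFull D.otherRot := D.otherRot_full
  have h3 := hτ.apply_eq_iff_pos.1 h
  have h4 := hτ.pos_lt D.root e
  have h5 : pos D.otherRot D.root e ≠ pos D.otherRot D.root D.secondary :=
    fun h => h2 (hτ.pos_injective _ h)
  exact ⟨hτ.pos_pos h1, show pos _ _ _ < pos _ _ _ by omega⟩

/-- Since all remaining edges end in Region 3, only the region at the root vertex matters, and its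
edges are counted by positions. -/
theorem beta_eq (h : D.otherRot D.secondary = D.root) :
    D.beta = D.rootPos D.secondary - 1 := by
  have hρ : IsFull D.rootRot := D.rootRot_full
  have := hρ.card_pos_between D.root (i := 0) (hρ.pos_lt D.root D.secondary).le
  rw [Nat.sub_zero] at this
  refine Eq.trans ?_ this
  refine Nat.card_congr (Equiv.subtypeEquivRight fun e => ⟨fun he => he.1, fun he => ⟨he, ?_⟩⟩)
  refine inRegion3_of_ne h ?_ ?_
  · rintro rfl
    have := he.1
    rw [pos_self] at this
    omega
  · rintro rfl
    exact lt_irrefl _ he.2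

theorem alpha_eq (h : D.otherRot D.secondary = D.root) :
    D.alpha = D.n - D.rootPos D.secondary - 1 := by
  have hρ : IsFull D.rootRot := D.rootRot_full
  have hc : Fintype.card (Fin D.n) = D.n := Fintype.card_fin _
  have := hρ.card_pos_between D.root (i := D.rootPos D.secondary) le_rfl
  rw [hc] at this
  rw [alpha, ← this]
  refine Nat.card_congr (Equiv.subtypeEquivRight fun e =>
    ⟨fun he => ⟨he.1, (hρ.pos_lt D.root e).trans_eq hc⟩, fun he => ⟨he.1, ?_⟩⟩)
  refine inRegion3_of_ne h ?_ ?_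
  · rintro rfl
    have := he.1
    rw [pos_self] at this
    omega
  · rintro rfl
    exact lt_irrefl _ he.1

end LabelledBirooted

/-! ### Coefficients of the series as sums over full cycles -/

/-- The genus of the dipole with rotations `ρ` and `τ`. -/
def rotGenus {E : Type} [Fintype E] (ρ τ : Perm E) : ℕ :=
  (Fintype.card E - Nat.card (Face (ρ⁻¹ * τ⁻¹))) / 2

/-- The cyclic permutations of all elements of `E`. -/
def fullCycles (E : Type) [Fintype E] [DecidableEq E] : Finset (Perm E) := by
  classical exact Finset.univ.filter IsFull

theorem mem_fullCycles {E : Type} [Fintype E] [DecidableEq E] {τ : Perm E} :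
    τ ∈ fullCycles E ↔ IsFull τ := by
  simp [fullCycles]

/-- Replaces a sum over isomorphism classes by a finite sum: `Θ` parametrises, without repetition,
all classes that can contribute to the given coefficient. -/
theorem formalSum_eq_sum {ι J : Type} (W : ι → DipoleSeries) (m : SeriesVar →₀ ℕ)
    (s : Finset J) (Θ : s → ι) (hΘ : Function.Injective Θ)
    (hW : ∀ i, i ∉ Set.range Θ → MvPowerSeries.coeff m (W i) = 0) (K : J → MarkPoly)
    (hK : ∀ j, MvPowerSeries.coeff m (W (Θ j)) = K j) :
    MvPowerSeries.coeff m (formalSum W) = ∑ j ∈ s, K j := by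
  have h1 : MvPowerSeries.coeff m (formalSum W) = ∑ᶠ i, MvPowerSeries.coeff m (W i) := rfl
  have h2 : ∑ᶠ i, MvPowerSeries.coeff m (W i) =
      ∑ᶠ (i) (_ : i ∈ Set.range Θ), MvPowerSeries.coeff m (W i) := by
    classical
    refine finsum_congr fun i => ?_
    by_cases h : i ∈ Set.range Θ
    · rw [finsum_eq_if, if_pos h]
    · rw [finsum_eq_if, if_neg h, hW i h]
  rw [h1, h2, finsum_mem_range hΘ, finsum_eq_sum_of_fintype, ← Finset.sum_coe_sort s]
  exact Finset.sum_congr rfl fun j _ => hK j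

/-! ### Transport of dipole statistics from an arbitrary edge set to `Fin n` -/

section Transport

variable {E : Type} [Fintype E] {ρ τ : Perm E} {r s : E}

theorem facePerm_transport {E : Type} {ρ τ : Perm E} {D : LabelledDipole} {π : E ≃ Fin D.n}
    (h1 : ∀ e, π (ρ e) = D.rootRot (π e)) (h2 : ∀ e, π (τ e) = D.otherRot (π e)) (e : E) :
    π ((ρ⁻¹ * τ⁻¹) e) = D.facePerm (π e) := by
  have h1' : ∀ e, π (ρ⁻¹ e) = D.rootRot⁻¹ (π e) := fun e => by
    rw [eq_inv_iff_eq, ← h1]; simp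
  have h2' : ∀ e, π (τ⁻¹ e) = D.otherRot⁻¹ (π e) := fun e => by
    rw [eq_inv_iff_eq, ← h2]; simp
  simp only [LabelledDipole.facePerm, mul_apply, h1', h2']

theorem genus_transport {D : LabelledDipole} {π : E ≃ Fin D.n}
    (h1 : ∀ e, π (ρ e) = D.rootRot (π e)) (h2 : ∀ e, π (τ e) = D.otherRot (π e)) :
    D.genus = rotGenus ρ τ := by
  have hn : Fintype.card E = D.n := by simpa using Fintype.card_congr π
  rw [LabelledDipole.genus, rotGenus, LabelledDipole.numFaces,
    Nat.card_congr (faceEquiv π (facePerm_transport h1 h2)), hn]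

theorem pos_transport {E E' : Type} {ρ : Perm E} {ρ' : Perm E'} {r : E} {π : E ≃ E'}
    (h1 : ∀ e, π (ρ e) = ρ' (π e)) (e : E) : pos ρ' (π r) (π e) = pos ρ r e := by
  simp only [pos, LabelledBirooted.pow_congr π h1, EmbeddingLike.apply_eq_iff_eq]

theorem allWhite_transport {D : LabelledDipole} {π : E ≃ Fin D.n}
    (h1 : ∀ e, π (ρ e) = D.rootRot (π e)) (h2 : ∀ e, π (τ e) = D.otherRot (π e)) :
    D.allWhite = ∏ᶠ F : Face (ρ⁻¹ * τ⁻¹), f (faceWord (ρ⁻¹ * τ⁻¹) (fun _ => Dot.white) F) :=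
  (finprod_eq_of_bijective _ (faceEquiv π (facePerm_transport h1 h2)).bijective fun F => by
    rw [faceWord_congr π (facePerm_transport h1 h2) (fun _ => rfl)]).symm

theorem faceMonomial_transport {D : LabelledBirooted} {π : E ≃ Fin D.n}
    (h1 : ∀ e, π (ρ e) = D.rootRot (π e)) (h2 : ∀ e, π (τ e) = D.otherRot (π e))
    (h3 : π r = D.root) (h4 : π s = D.secondary) :
    g D.rootWord * D.nonRootFaces = faceMonomial (ρ⁻¹ * τ⁻¹) (markOf ρ r s) r := by
  have hφ := facePerm_transport h1 h2
  have hm : ∀ e, D.mark (π e) = markOf ρ r s e := fun e => by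
    change markOf D.rootRot D.root D.secondary (π e) = _
    rw [markOf, markOf, ← h3, ← h4, pos_transport h1, pos_transport h1]
  rw [faceMonomial, LabelledBirooted.rootWord, ← h3, walk_congr π hφ hm]
  congr 1
  refine (finprod_eq_of_bijective _ (faceEquiv π hφ).bijective fun F => ?_).symm
  have hr : faceEquiv π hφ (Quotient.mk _ r) = Quotient.mk _ D.root := by
    rw [← h3]
    rfl
  rw [faceWord_congr π hφ hm, ← hr]
  simp only [ne_eq, EmbeddingLike.apply_eq_iff_eq]

end Transport

/-! ### Rooted dipoles as full cycles, and the coefficients of A -/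

section Rooted

variable {E : Type} [Fintype E] {ρ τ : Perm E}

/-- The rooted dipole with given rotations, transported to `Fin n`. -/
def dipole (hρ : IsFull ρ) (hτ : IsFull τ) (r : E) : LabelledDipole where
  n := Fintype.card E
  rootRot := (Fintype.equivFin E).permCongr ρ
  otherRot := (Fintype.equivFin E).permCongr τ
  rootRot_full := hρ.permCongr _
  otherRot_full := hτ.permCongr _
  root := Fintype.equivFin E r

/-- The edges of `dipole hρ hτ r` are the elements of `E`. -/
def dipoleEquiv (hρ : IsFull ρ) (hτ : IsFull τ) (r : E) : E ≃ Fin (dipole hρ hτ r).n :=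
  Fintype.equivFin E

theorem dipole_rootRot (hρ : IsFull ρ) (hτ : IsFull τ) (r e : E) :
    dipoleEquiv hρ hτ r (ρ e) = (dipole hρ hτ r).rootRot (dipoleEquiv hρ hτ r e) :=
  (by simp : Fintype.equivFin E (ρ e) =
    (Fintype.equivFin E).permCongr ρ (Fintype.equivFin E e))

theorem dipole_otherRot (hρ : IsFull ρ) (hτ : IsFull τ) (r e : E) :
    dipoleEquiv hρ hτ r (τ e) = (dipole hρ hτ r).otherRot (dipoleEquiv hρ hτ r e) :=
  (by simp : Fintype.equivFin E (τ e) =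
    (Fintype.equivFin E).permCongr τ (Fintype.equivFin E e))

/-- With `ρ` and `r` fixed, rigidity forces the isomorphism to be the identity on `E`, so no two
full cycles `τ` give the same class. -/
theorem eq_of_dipole_isIso (hρ : IsFull ρ) {τ τ' : Perm E} (hτ : IsFull τ) (hτ' : IsFull τ')
    {r : E} {π : Fin (dipole hρ hτ r).n ≃ Fin (dipole hρ hτ' r).n}
    (h : LabelledDipole.IsIso (dipole hρ hτ r) (dipole hρ hτ' r) π) : τ = τ' := by
  let κ : E ≃ E := ((dipoleEquiv hρ hτ r).trans π).trans (dipoleEquiv hρ hτ' r).symm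
  have hκ : ∀ e, dipoleEquiv hρ hτ' r (κ e) = π (dipoleEquiv hρ hτ r e) := fun e => by
    simp [κ]
  have h1 : ∀ e, κ (ρ e) = ρ (κ e) := fun e => (dipoleEquiv hρ hτ' r).injective <| by
    rw [hκ, dipole_rootRot hρ hτ r, h.rootRot, dipole_rootRot hρ hτ' r, hκ]
  have h2 : ∀ e, κ (τ e) = τ' (κ e) := fun e => (dipoleEquiv hρ hτ' r).injective <| by
    rw [hκ, dipole_otherRot hρ hτ r, h.otherRot, dipole_otherRot hρ hτ' r, hκ]
  have h3 : κ r = r := (dipoleEquiv hρ hτ' r).injective <| by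
    rw [hκ]
    exact h.root
  ext e
  have := h2 e
  rwa [hρ.eq_refl_of_commute h1 h3, hρ.eq_refl_of_commute h1 h3] at this

/-- Every labelled dipole with the right number of edges has root rotation `ρ`, up to
isomorphism. -/
theorem exists_dipole_equiv (hρ : IsFull ρ) (r : E) (D : LabelledDipole)
    (hn : Fintype.card E = D.n) :
    ∃ (τ : Perm E) (_ : IsFull τ) (π : E ≃ Fin D.n), (∀ e, π (ρ e) = D.rootRot (π e)) ∧
      (∀ e, π (τ e) = D.otherRot (π e)) ∧ π r = D.root := by
  obtain ⟨π, h1, h3⟩ := hρ.exists_equiv (ρ' := D.rootRot) D.rootRot_full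
    (by rw [hn, Fintype.card_fin]) r D.root
  exact ⟨π.symm.permCongr D.otherRot, IsFull.permCongr D.otherRot_full _, π, h1,
    fun e => by simp [Equiv.permCongr_apply], h3⟩

theorem dipole_isIso (hρ : IsFull ρ) (hτ : IsFull τ) {r : E} {D : LabelledDipole}
    {π : E ≃ Fin D.n} (h1 : ∀ e, π (ρ e) = D.rootRot (π e))
    (h2 : ∀ e, π (τ e) = D.otherRot (π e)) (h3 : π r = D.root) :
    LabelledDipole.IsIso (dipole hρ hτ r) D ((dipoleEquiv hρ hτ r).symm.trans π) where
  rootRot e := by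
    obtain ⟨e, rfl⟩ := (dipoleEquiv hρ hτ r).surjective e
    rw [← dipole_rootRot hρ hτ r]
    simp [h1]
  otherRot e := by
    obtain ⟨e, rfl⟩ := (dipoleEquiv hρ hτ r).surjective e
    rw [← dipole_otherRot hρ hτ r]
    simp [h2]
  root := by
    rw [← h3]
    exact congrArg π ((dipoleEquiv hρ hτ r).symm_apply_apply r)

theorem coeff_rooted_weight_eq_zero {D : LabelledDipole} {m : SeriesVar →₀ ℕ}
    (h : m SeriesVar.x ≠ D.n ∨ m SeriesVar.y ≠ 0) :
    MvPowerSeries.coeff m D.weight = 0 := by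
  classical
  rw [LabelledDipole.weight, MvPowerSeries.coeff_monomial, if_neg]
  rintro rfl
  simp at h

theorem coeff_rooted_weight (D : LabelledDipole) {m : SeriesVar →₀ ℕ} (hx : m SeriesVar.x = D.n)
    (hy : m SeriesVar.y = 0) : MvPowerSeries.coeff m D.weight =
      (1 / (D.n.factorial : ℚ)) • if 2 * D.genus = m SeriesVar.u then D.allWhite else 0 := by
  classical
  rw [LabelledDipole.weight, MvPowerSeries.coeff_monomial, smul_ite, smul_zero,
    MvPolynomial.C_mul']
  refine if_congr ⟨?_, ?_⟩ rfl rfl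
  · rintro rfl
    simp
  · intro hu
    ext v
    cases v <;> simp [hx, hy, hu]

/-- The edge set and `ρ` are left arbitrary so that insertion can be carried out on `Option E`
without relabelling. -/
theorem coeff_seriesA [DecidableEq E] (hρ : IsFull ρ) (r : E) {m : SeriesVar →₀ ℕ}
    (hx : m SeriesVar.x = Fintype.card E) (hy : m SeriesVar.y = 0) :
    MvPowerSeries.coeff m seriesA = (1 / ((Fintype.card E).factorial : ℚ)) •
      ∑ τ ∈ fullCycles E, if 2 * rotGenus ρ τ = m SeriesVar.u then g [Dot.black] *
        ∏ᶠ F : Face (ρ⁻¹ * τ⁻¹), f (faceWord (ρ⁻¹ * τ⁻¹) (fun _ => Dot.white) F) else 0 := by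
  rw [seriesA, MvPowerSeries.coeff_C_mul]
  rw [formalSum_eq_sum RootedDipole.weight m (fullCycles E)
    (fun τ => Quotient.mk _ (dipole hρ (mem_fullCycles.1 τ.2) r)) ?_ ?_
    (fun τ => (1 / ((Fintype.card E).factorial : ℚ)) •
      if 2 * rotGenus ρ τ = m SeriesVar.u then
        ∏ᶠ F : Face (ρ⁻¹ * τ⁻¹), f (faceWord (ρ⁻¹ * τ⁻¹) (fun _ => Dot.white) F) else 0) ?_]
  · rw [Finset.mul_sum, Finset.smul_sum]
    refine Finset.sum_congr rfl fun τ _ => ?_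
    rw [mul_smul_comm, mul_ite, mul_zero]
  · intro τ τ' h
    obtain ⟨π, hπ⟩ := Quotient.exact h
    exact Subtype.ext (eq_of_dipole_isIso hρ _ _ hπ)
  · intro D hD
    induction D using Quotient.inductionOn with
    | h D =>
      refine coeff_rooted_weight_eq_zero (Or.inl fun hn => hD ?_)
      obtain ⟨τ, hτ, π, h1, h2, h3⟩ := exists_dipole_equiv hρ r D (hx.symm.trans hn)
      exact ⟨⟨τ, mem_fullCycles.2 hτ⟩, Quotient.sound ⟨_, dipole_isIso hρ hτ h1 h2 h3⟩⟩
  · intro τ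
    have hτ := mem_fullCycles.1 τ.2
    refine (coeff_rooted_weight (dipole hρ hτ r) hx hy).trans ?_
    rw [genus_transport (dipole_rootRot hρ hτ r) (dipole_otherRot hρ hτ r),
      allWhite_transport (dipole_rootRot hρ hτ r) (dipole_otherRot hρ hτ r)]
    rfl

theorem coeff_seriesA_eq_zero {m : SeriesVar →₀ ℕ}
    (h : m SeriesVar.x = 0 ∨ m SeriesVar.y ≠ 0) : MvPowerSeries.coeff m seriesA = 0 := by
  rw [seriesA, MvPowerSeries.coeff_C_mul]
  rw [show MvPowerSeries.coeff m (formalSum RootedDipole.weight) =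
    ∑ᶠ D : RootedDipole, MvPowerSeries.coeff m D.weight from rfl, finsum_eq_zero_of_forall_eq_zero,
    mul_zero]
  intro D
  induction D using Quotient.inductionOn with
  | h D =>
    refine coeff_rooted_weight_eq_zero (h.imp_left fun h0 hn => ?_)
    exact (Fin.cast (hn.symm.trans h0) D.root).elim0

end Rooted

/-! ### Birooted dipoles as full cycles with prescribed secondary edge, and the coefficients of B -/

section Birooted

variable {E : Type} [Fintype E] {ρ τ : Perm E} {r s : E}

/-- The full cycles with `s` followed by `r`. -/
def fullCyclesTo {E : Type} [Fintype E] [DecidableEq E] (s r : E) : Finset (Perm E) :=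
  (fullCycles E).filter fun τ => τ s = r

theorem mem_fullCyclesTo [DecidableEq E] :
    τ ∈ fullCyclesTo s r ↔ IsFull τ ∧ τ s = r := by
  rw [fullCyclesTo, Finset.mem_filter, mem_fullCycles]

/-- The birooted dipole with given rotations, transported to `Fin n`. -/
def birooted (hρ : IsFull ρ) (hτ : IsFull τ) (hs : s ≠ r) : LabelledBirooted where
  toLabelledDipole := dipole hρ hτ r
  secondary := dipoleEquiv hρ hτ r s
  secondary_ne_root h := hs ((dipoleEquiv hρ hτ r).injective h)

theorem birooted_gamma_delta (hρ : IsFull ρ) (hτ : IsFull τ) (hs : s ≠ r) (h : τ s = r) :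
    (birooted hρ hτ hs).gamma = 0 ∧ (birooted hρ hτ hs).delta = 0 := by
  rw [LabelledBirooted.gamma_eq_zero_and_delta_eq_zero_iff]
  refine (dipole_otherRot hρ hτ r s).symm.trans ?_
  rw [h]
  rfl

theorem birooted_rootPos (hρ : IsFull ρ) (hτ : IsFull τ) (hs : s ≠ r) :
    (birooted hρ hτ hs).rootPos (birooted hρ hτ hs).secondary = pos ρ r s :=
  pos_transport (dipole_rootRot hρ hτ r) s

theorem coeff_birooted_weight_eq_zero {D : LabelledBirooted} {m : SeriesVar →₀ ℕ}
    (h : ¬ (m SeriesVar.x = D.alpha + 1 ∧ m SeriesVar.y = D.beta)) :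
    MvPowerSeries.coeff m D.weight = 0 := by
  classical
  rw [LabelledBirooted.weight, MvPowerSeries.coeff_monomial, if_neg]
  rintro rfl
  simp at h

theorem coeff_birooted_weight (D : LabelledBirooted) {m : SeriesVar →₀ ℕ}
    (hx : m SeriesVar.x = D.alpha + 1) (hy : m SeriesVar.y = D.beta) :
    MvPowerSeries.coeff m D.weight =
      (1 / ((D.alpha + 1).factorial : ℚ) * (1 / (D.beta.factorial : ℚ))) •
        if 2 * D.genus = m SeriesVar.u then g D.rootWord * D.nonRootFaces else 0 := by
  classical
  rw [LabelledBirooted.weight, MvPowerSeries.coeff_monomial, smul_ite, smul_zero,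
    MvPolynomial.C_mul']
  refine if_congr ⟨?_, ?_⟩ rfl rfl
  · rintro rfl
    simp
  · intro hu
    ext v
    cases v <;> simp [hx, hy, hu]

theorem coeff_seriesB [DecidableEq E] (hρ : IsFull ρ) (hs : s ≠ r) {a b : ℕ}
    (hc : Fintype.card E = a + b + 2) (hb : pos ρ r s = b + 1) {m : SeriesVar →₀ ℕ}
    (hx : m SeriesVar.x = a + 1) (hy : m SeriesVar.y = b) :
    MvPowerSeries.coeff m seriesB =
      (1 / ((a + 1).factorial : ℚ) * (1 / (b.factorial : ℚ))) •
        ∑ τ ∈ fullCyclesTo s r, if 2 * rotGenus ρ τ = m SeriesVar.u then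
          faceMonomial (ρ⁻¹ * τ⁻¹) (markOf ρ r s) r else 0 := by
  rw [seriesB, Finset.smul_sum]
  refine formalSum_eq_sum _ m (fullCyclesTo s r)
    (fun τ => ⟨Quotient.mk _ (birooted hρ (mem_fullCyclesTo.1 τ.2).1 hs),
      birooted_gamma_delta hρ _ hs (mem_fullCyclesTo.1 τ.2).2⟩) ?_ ?_ _ ?_
  · intro τ τ' h
    obtain ⟨π, hπ⟩ := Quotient.exact (congrArg Subtype.val h)
    exact Subtype.ext (eq_of_dipole_isIso hρ (mem_fullCyclesTo.1 τ.2).1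
      (mem_fullCyclesTo.1 τ'.2).1 hπ.toDipole)
  · rintro ⟨D, hD⟩ hD'
    induction D using Quotient.inductionOn with
    | h D =>
      refine coeff_birooted_weight_eq_zero fun hxy => hD' ?_
      have hD2 := (D.gamma_eq_zero_and_delta_eq_zero_iff).1 hD
      have hα := D.alpha_eq hD2
      have hβ := D.beta_eq hD2
      have hlt : D.rootPos D.secondary < D.n :=
        (IsFull.pos_lt D.rootRot_full D.root D.secondary).trans_eq (Fintype.card_fin _)
      have hpos : 0 < D.rootPos D.secondary :=
        IsFull.pos_pos D.rootRot_full D.secondary_ne_root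
      obtain ⟨τ, hτ, π, h1, h2, h3⟩ := exists_dipole_equiv hρ r D.toLabelledDipole (by omega)
      -- Both edges are at position `b + 1` after the root at the root vertex, and a position
      -- determines the edge.
      have h4 : π s = D.secondary := by
        refine D.rootPos_injective ?_
        refine Eq.trans ?_ (show b + 1 = _ by omega)
        rw [← hb, ← pos_transport h1, h3]
        rfl
      have h5 : τ s = r := π.injective (by rw [h2, h4, hD2, h3])
      refine ⟨⟨τ, mem_fullCyclesTo.2 ⟨hτ, h5⟩⟩, Subtype.ext (Quotient.sound
        ⟨_, dipole_isIso hρ hτ h1 h2 h3, ?_⟩)⟩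
      rw [← h4]
      exact congrArg π ((dipoleEquiv hρ hτ r).symm_apply_apply s)
  · intro τ
    have hτ := (mem_fullCyclesTo.1 τ.2).1
    set D := birooted hρ hτ hs with hD
    have hD2 : D.otherRot D.secondary = D.root :=
      (D.gamma_eq_zero_and_delta_eq_zero_iff).1
        (birooted_gamma_delta hρ _ hs (mem_fullCyclesTo.1 τ.2).2)
    have hp : D.rootPos D.secondary = b + 1 := (birooted_rootPos hρ hτ hs).trans hb
    have hα : D.alpha = a := by
      rw [D.alpha_eq hD2, hp, show D.n = Fintype.card E from rfl]
      omega
    have hβ : D.beta = b := by rw [D.beta_eq hD2, hp]; omega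
    refine (coeff_birooted_weight D (by rw [hα, hx]) (by rw [hβ, hy])).trans ?_
    rw [hα, hβ, genus_transport (D := D.toLabelledDipole) (dipole_rootRot hρ hτ r)
      (dipole_otherRot hρ hτ r), faceMonomial_transport (D := D) (dipole_rootRot hρ hτ r)
      (dipole_otherRot hρ hτ r) rfl rfl]

theorem coeff_seriesB_eq_zero {m : SeriesVar →₀ ℕ} (h : m SeriesVar.x = 0) :
    MvPowerSeries.coeff m seriesB = 0 := by
  rw [show MvPowerSeries.coeff m seriesB =
    ∑ᶠ D : {D : BirootedDipole // D.gamma = 0 ∧ D.delta = 0},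
      MvPowerSeries.coeff m D.1.weight from rfl, finsum_eq_zero_of_forall_eq_zero]
  rintro ⟨D, hD⟩
  induction D using Quotient.inductionOn with
  | h D =>
    refine coeff_birooted_weight_eq_zero ?_
    omega

end Birooted

/-! ### The differential equation -/

/-! ### Removing the inserted edge -/

section Decompose

variable {E : Type} [DecidableEq E] {τ : Perm E} {r s : E}

/-- `insertEdge` is by definition one branch of the inverse of `decomposeOption`. -/
theorem insertEdge_injective {τ τ' : Perm E} {q q' : E} (h : insertEdge τ q = insertEdge τ' q') :
    τ = τ' ∧ q = q' := by
  have h' := decomposeOption.symm.injective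
    (show decomposeOption.symm (some q, τ) = decomposeOption.symm (some q', τ') from h)
  simpa [and_comm] using h'

/-- The new edge may go anywhere except between `s` and `r`, where it would enter Region 4. -/
theorem insertEdge_some_eq_some_iff {q : E} :
    insertEdge τ q (some s) = some r ↔ τ s = r ∧ q ≠ r := by
  by_cases h : τ s = q
  · rw [insertEdge_some_of_eq h]
    simp only [reduceCtorEq, false_iff, not_and, not_not]
    exact fun hr => h.symm.trans hr
  · rw [insertEdge_some_of_ne h, Option.some_inj]
    exact ⟨fun hr => ⟨hr, fun hq => h (hr.trans hq.symm)⟩, fun hr => hr.1⟩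

end Decompose

/-! ### Sums over full cycles under insertion -/

section Recursion

variable {E : Type} [Fintype E] [DecidableEq E] {ρ τ : Perm E} {r s : E}

/-- A permutation of `Option E` is an insertion unless it fixes `none`, which a full cycle on at
least two points cannot do. -/
theorem exists_eq_insertEdge [Nonempty E] {σ : Perm (Option E)} (hσ : IsFull σ) :
    ∃ (τ : Perm E) (q : E), σ = insertEdge τ q := by
  obtain ⟨e⟩ := ‹Nonempty E›
  obtain ⟨⟨o, τ⟩, rfl⟩ := decomposeOption.symm.surjective σ
  rcases o with _ | q
  · exfalso
    obtain ⟨i, -, hi⟩ := (hσ none (some e)).exists_pow_eq'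
    have hfix : ∀ i : ℕ, (decomposeOption.symm (none, τ) ^ i) none = none := by
      intro i
      induction i with
      | zero => rfl
      | succ k ih => rw [pow_succ', mul_apply, ih]; simp
    rw [hfix] at hi
    exact Option.some_ne_none _ hi.symm
  · exact ⟨τ, q, rfl⟩

theorem sum_fullCyclesTo_some {M : Type} [AddCommMonoid M] (s r : E) (K : Perm (Option E) → M) :
    ∑ σ ∈ fullCyclesTo (some s) (some r), K σ =
      ∑ τ ∈ fullCyclesTo s r, ∑ q ∈ Finset.univ.erase r, K (insertEdge τ q) := by
  have : Nonempty E := ⟨s⟩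
  rw [← Finset.sum_product']
  symm
  refine Finset.sum_nbij (fun x => insertEdge x.1 x.2) ?_ ?_ ?_ fun _ _ => rfl
  · rintro ⟨τ, q⟩ h
    rw [Finset.mem_product, mem_fullCyclesTo, Finset.mem_erase] at h
    exact mem_fullCyclesTo.2 ⟨IsFull.insertEdge_iff.2 h.1.1,
      insertEdge_some_eq_some_iff.2 ⟨h.1.2, h.2.1⟩⟩
  · rintro ⟨τ, q⟩ - ⟨τ', q'⟩ - h
    exact Prod.ext (insertEdge_injective h).1 (insertEdge_injective h).2
  · intro σ h
    obtain ⟨h1, h2⟩ := mem_fullCyclesTo.1 (Finset.mem_coe.1 h)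
    obtain ⟨τ, q, rfl⟩ := exists_eq_insertEdge h1
    have h3 := insertEdge_some_eq_some_iff.1 h2
    refine ⟨(τ, q), ?_, rfl⟩
    rw [Finset.mem_coe, Finset.mem_product, mem_fullCyclesTo, Finset.mem_erase]
    exact ⟨⟨IsFull.insertEdge_iff.1 h1, h3.1⟩, h3.2, Finset.mem_univ _⟩

/-- Here the secondary edge is the new one, and its successor `r` fixes where it goes; removing it
leaves an unrestricted full cycle. -/
theorem sum_fullCyclesTo_none {M : Type} [AddCommMonoid M] (r : E) (K : Perm (Option E) → M) :
    ∑ σ ∈ fullCyclesTo none (some r), K σ = ∑ τ ∈ fullCycles E, K (insertEdge τ r) := by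
  have : Nonempty E := ⟨r⟩
  symm
  refine Finset.sum_nbij (fun τ => insertEdge τ r) ?_ ?_ ?_ fun _ _ => rfl
  · intro τ h
    exact mem_fullCyclesTo.2 ⟨IsFull.insertEdge_iff.2 (mem_fullCycles.1 h), insertEdge_none _ _⟩
  · intro τ _ τ' _ h
    exact (insertEdge_injective h).1
  · intro σ h
    obtain ⟨h1, h2⟩ := mem_fullCyclesTo.1 (Finset.mem_coe.1 h)
    obtain ⟨τ, q, rfl⟩ := exists_eq_insertEdge h1
    rw [insertEdge_none, Option.some_inj] at h2
    subst h2
    exact ⟨τ, mem_fullCycles.2 (IsFull.insertEdge_iff.1 h1), rfl⟩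

theorem card_face_le {E : Type} [Fintype E] (φ : Perm E) : Nat.card (Face φ) ≤ Fintype.card E := by
  rw [← Nat.card_eq_fintype_card]
  exact Nat.card_le_card_of_surjective _ Quotient.mk_surjective

/-- The cut-join identity for one fixed `τ`, sorted by genus. -/
theorem sum_insertEdge (hρ : IsFull ρ) (hs : s ≠ r) (u : ℕ) :
    (∑ q ∈ Finset.univ.erase r,
      if 2 * rotGenus (insertEdge ρ (ρ r)) (insertEdge τ q) = u then
        faceMonomial ((insertEdge ρ (ρ r))⁻¹ * (insertEdge τ q)⁻¹)
          (markOf (insertEdge ρ (ρ r)) (some r) (some s)) (some r) else 0) =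
      (if 2 * rotGenus ρ τ = u then
        cutPoly (faceMonomial (ρ⁻¹ * τ⁻¹) (markOf ρ r s) r) else 0) +
      if 2 * rotGenus ρ τ + 2 = u then
        joinPoly (faceMonomial (ρ⁻¹ * τ⁻¹) (markOf ρ r s) r) else 0 := by
  set φ := ρ⁻¹ * τ⁻¹ with hφ
  let Φ : E → Perm (Option E) := fun p =>
    (insertEdge ρ (ρ r))⁻¹ * (insertEdge τ (φ⁻¹ p))⁻¹
  have hΦ : ∀ p x, Φ p x = swap none (some r) (swap none (some p) (x.map φ)) := fun p x => by
    have hp : φ (φ⁻¹ p) = p := by simp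
    rw [inv_insertEdge_mul_inv_insertEdge, ← hφ, hp]
  have key := sum_faceMonomial_insert φ (markOf ρ r s)
    (markOf (insertEdge ρ (ρ r)) (some r) (some s)) r (hρ.markOf_insertEdge_some hs)
    (hρ.markOf_insertEdge_none hs) Φ hΦ
    -- The weight selects the genus: a dipole with `k` faces and one edge more than before
    -- contributes exactly to `u`.
    (fun k => if 2 * ((Fintype.card E + 1 - k) / 2) = u then 1 else 0)
  have hle := card_face_le φ
  have hpos : 0 < Nat.card (Face φ) := by
    have : Nonempty (Face φ) := ⟨Quotient.mk _ r⟩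
    exact Nat.card_pos
  have e1 : 2 * ((Fintype.card E + 1 - (Nat.card (Face φ) + 1)) / 2) = 2 * rotGenus ρ τ := by
    rw [rotGenus, ← hφ, Nat.add_sub_add_right]
  -- The number of edges minus the number of faces rises by exactly two, so halving adds one
  -- whatever the parity. The bounds on the number of faces keep the truncated subtractions exact.
  have e2 : 2 * ((Fintype.card E + 1 - (Nat.card (Face φ) - 1)) / 2) =
      2 * rotGenus ρ τ + 2 := by
    rw [rotGenus, ← hφ]
    omega
  simp only [e1, e2, ite_smul, one_smul, zero_smul] at key
  rw [← key]
  -- Reindexing by `p = φ q`, which turns the condition `q ≠ r` into `p ≠ φ r`.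
  refine Finset.sum_nbij φ ?_ φ.injective.injOn ?_ ?_
  · intro q hq
    rw [Finset.mem_erase] at hq ⊢
    exact ⟨fun h => hq.1 (φ.injective h), Finset.mem_univ _⟩
  · intro p hp
    rw [Finset.mem_coe, Finset.mem_erase] at hp
    refine ⟨φ⁻¹ p, ?_, by simp⟩
    rw [Finset.mem_coe, Finset.mem_erase]
    refine ⟨fun h => hp.1 ?_, Finset.mem_univ _⟩
    rw [← h]
    simp
  · intro q _
    have hq : φ⁻¹ (φ q) = q := by simp
    simp only [Φ, hq, rotGenus, Fintype.card_option]

/-- Doubling the root edge cuts off a digon with root word black. The rest of the old root face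
regains its length through the corner of the new edge, and all its corners are white; there is one
more edge and one more face, so the genus is unchanged. -/
theorem faceMonomial_insertEdge_secondary (hρ : IsFull ρ) (τ : Perm E) (r : E) :
    rotGenus (insertEdge ρ (ρ r)) (insertEdge τ r) = rotGenus ρ τ ∧
    faceMonomial ((insertEdge ρ (ρ r))⁻¹ * (insertEdge τ r)⁻¹)
        (markOf (insertEdge ρ (ρ r)) (some r) none) (some r) =
      g [Dot.black] *
        ∏ᶠ F : Face (ρ⁻¹ * τ⁻¹), f (faceWord (ρ⁻¹ * τ⁻¹) (fun _ => Dot.white) F) := by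
  have : Nonempty E := ⟨r⟩
  obtain ⟨t, N, h⟩ := exists_isDecomp (ρ⁻¹ * τ⁻¹) r
  have hmap : (r :: t).map (ρ⁻¹ * τ⁻¹) = t ++ [r] :=
    (h.map_eq _ (Multiset.mem_cons_self _ _)).trans (by simp)
  have hp : t ++ [r] = (ρ⁻¹ * τ⁻¹) r :: t.map (ρ⁻¹ * τ⁻¹) := by rw [← hmap, List.map_cons]
  have h' : IsDecomp (ρ⁻¹ * τ⁻¹) ((r :: [] ++ t) ::ₘ N) := h
  have hφ' := inv_insertEdge_mul_inv_insertEdge ρ τ r r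
  have hnd := h.nodup_of_mem (Multiset.mem_cons_self _ _)
  constructor
  · rw [rotGenus, rotGenus, (h'.cut hp hφ').card_face, h.card_face]
    simp
  · rw [faceMonomial_cut (mark := fun z => if z = r then Dot.black else Dot.white) h' hp hφ'
      fun z => by simp [hρ.markOf_insertEdge_secondary], h.prod_faceWord,
      hρ.markOf_insertEdge_secondary, Multiset.map_cons, Multiset.prod_cons]
    have hwhite : ∀ l : List E, r ∉ l →
        l.map (fun z => if z = r then Dot.black else Dot.white) = l.map fun _ => Dot.white :=
      fun l hl => List.map_congr_left fun z hz => if_neg <| by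
        rintro rfl
        exact hl hz
    rw [hwhite t (List.nodup_cons.1 hnd).1]
    have hN : N.map (fun l => f ((l.map fun z => if z = r then Dot.black else Dot.white : List Dot) :
        Cycle Dot)) = N.map fun l => f ((l.map fun _ => Dot.white : List Dot) : Cycle Dot) :=
      Multiset.map_congr rfl fun l hl => by
        rw [hwhite l (h.notMem_of_mem hl List.mem_cons_self)]
    rw [hN]
    simp

end Recursion

/-! ### The initial condition, the recursion and uniqueness -/

theorem exists_isFull (n : ℕ) : ∃ ρ : Perm (Fin (n + 1)), IsFull ρ := by
  rcases n with _ | n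
  -- A single point is treated apart: there the rotation is the identity, which does not satisfy
  -- `IsCycle`.
  · exact ⟨1, fun e e' => (show e = e' by omega) ▸ SameCycle.refl _ _⟩
  · refine ⟨finRotate (n + 2), fun e e' => isCycle_finRotate.sameCycle ?_ ?_⟩ <;>
    · rw [← mem_support, support_finRotate]
      exact Finset.mem_univ _

theorem atYZero_seriesB : atYZero seriesB = seriesA := by
  ext1 m
  change (if m SeriesVar.y = 0 then MvPowerSeries.coeff m seriesB else 0) = _
  by_cases hy : m SeriesVar.y = 0
  · rw [if_pos hy]
    rcases hx : m SeriesVar.x with _ | a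
    · rw [coeff_seriesB_eq_zero hx, coeff_seriesA_eq_zero (Or.inl hx)]
    · obtain ⟨ρ, hρ⟩ := exists_isFull a
      have hc : Fintype.card (Fin (a + 1)) = a + 1 := Fintype.card_fin _
      -- The model for B is the model for A with the secondary edge `none` inserted right after the
      -- root. So A has `a + 1` edges and B has `a + 2`, which accounts for the exponent α + 1 of x.
      rw [coeff_seriesA hρ 0 (hx.trans hc.symm) hy, coeff_seriesB (IsFull.insertEdge_iff.2 hρ)
        (r := some 0) (s := none) (by simp) (a := a) (b := 0)
        (by rw [Fintype.card_option, hc]) (hρ.pos_insertEdge_none 0) hx hy,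
        sum_fullCyclesTo_none, hc]
      congr 1
      · simp
      · refine Finset.sum_congr rfl fun τ _ => ?_
        obtain ⟨h1, h2⟩ := faceMonomial_insertEdge_secondary hρ τ 0
        rw [h1, h2]
  · rw [if_neg hy, coeff_seriesA_eq_zero (Or.inr hy)]

theorem cutPoly_zero : cutPoly 0 = 0 := cutLin.map_zero

theorem joinPoly_zero : joinPoly 0 = 0 := joinLin.map_zero

theorem coeff_cut_add_join (F : DipoleSeries) (m : SeriesVar →₀ ℕ) :
    MvPowerSeries.coeff m (cutOp F + MvPowerSeries.X SeriesVar.u ^ 2 * joinOp F) =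
      cutPoly (MvPowerSeries.coeff m F) + if 2 ≤ m SeriesVar.u then
        joinPoly (MvPowerSeries.coeff (m - Finsupp.single SeriesVar.u 2) F) else 0 := by
  classical
  rw [map_add, MvPowerSeries.X_pow_eq, MvPowerSeries.coeff_monomial_mul]
  simp only [Finsupp.single_le_iff, one_mul]
  rfl

/-- The differential equation, coefficient by coefficient. Both sides are sums over the same `τ`,
with the coefficient at `y^(b+1)` computed on `Option E` after one insertion. -/
theorem coeff_seriesB_recursion (m : SeriesVar →₀ ℕ) :
    cutPoly (MvPowerSeries.coeff m seriesB) + (if 2 ≤ m SeriesVar.u then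
        joinPoly (MvPowerSeries.coeff (m - Finsupp.single SeriesVar.u 2) seriesB) else 0) =
      MvPowerSeries.coeff (m + Finsupp.single SeriesVar.y 1) seriesB *
        ((m SeriesVar.y : MarkPoly) + 1) := by
  rcases hx : m SeriesVar.x with _ | a
  · rw [coeff_seriesB_eq_zero hx, coeff_seriesB_eq_zero (m := m + _) (by simp [hx]),
      coeff_seriesB_eq_zero (m := m - _) (by simp [hx]), cutPoly_zero, joinPoly_zero]
    simp
  obtain ⟨b, hb⟩ : ∃ b, m SeriesVar.y = b := ⟨_, rfl⟩
  obtain ⟨ρ, hρ⟩ := exists_isFull (a + b + 1)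
  have hc : Fintype.card (Fin (a + b + 1 + 1)) = a + b + 2 := Fintype.card_fin _
  let r : Fin (a + b + 1 + 1) := 0
  -- This position leaves exactly `b` edges in Region 1.
  let s := (ρ ^ (b + 1)) r
  have hps : pos ρ r s = b + 1 := hρ.pos_eq (by omega) rfl
  have hs : s ≠ r := fun h => by
    rw [h, pos_self] at hps
    omega
  rw [coeff_seriesB hρ hs hc hps hx hb,
    coeff_seriesB (IsFull.insertEdge_iff.2 hρ) (r := some r) (s := some s) (by simpa using hs)
      (a := a) (b := b + 1) (m := m + Finsupp.single SeriesVar.y 1)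
      (by rw [Fintype.card_option, hc]; omega)
      (by rw [hρ.pos_insertEdge_some hs, hps]) (by simp [hx]) (by simp [hb]),
    sum_fullCyclesTo_some, coeff_seriesB hρ hs hc hps (m := m - _) (by simp [hx])
      (by simp [hb])]
  have hsum : ∑ τ ∈ fullCyclesTo s r, ∑ q ∈ Finset.univ.erase r,
      (if 2 * rotGenus (insertEdge ρ (ρ r)) (insertEdge τ q) =
          (m + Finsupp.single SeriesVar.y 1 : SeriesVar →₀ ℕ) SeriesVar.u then
        faceMonomial ((insertEdge ρ (ρ r))⁻¹ * (insertEdge τ q)⁻¹)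
          (markOf (insertEdge ρ (ρ r)) (some r) (some s)) (some r) else 0) =
      (∑ τ ∈ fullCyclesTo s r, if 2 * rotGenus ρ τ = m SeriesVar.u then
        cutPoly (faceMonomial (ρ⁻¹ * τ⁻¹) (markOf ρ r s) r) else 0) +
      ∑ τ ∈ fullCyclesTo s r, if 2 * rotGenus ρ τ + 2 = m SeriesVar.u then
        joinPoly (faceMonomial (ρ⁻¹ * τ⁻¹) (markOf ρ r s) r) else 0 := by
    rw [← Finset.sum_add_distrib]
    refine Finset.sum_congr rfl fun τ _ => ?_
    rw [sum_insertEdge hρ hs]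
    simp
  have hcut : ∀ (T : Finset (Perm (Fin (a + b + 1 + 1)))) (K : Perm (Fin (a + b + 1 + 1)) → MarkPoly)
      (P : Perm (Fin (a + b + 1 + 1)) → Prop) [DecidablePred P],
      cutPoly (∑ τ ∈ T, if P τ then K τ else 0) = ∑ τ ∈ T, if P τ then cutPoly (K τ) else 0 := by
    intro T K P _
    refine (map_sum cutLin _ _).trans (Finset.sum_congr rfl fun τ _ => ?_)
    rw [apply_ite cutLin, map_zero]
    rfl
  have hjoin : ∀ (T : Finset (Perm (Fin (a + b + 1 + 1)))) (K : Perm (Fin (a + b + 1 + 1)) → MarkPoly)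
      (P : Perm (Fin (a + b + 1 + 1)) → Prop) [DecidablePred P],
      joinPoly (∑ τ ∈ T, if P τ then K τ else 0) =
        ∑ τ ∈ T, if P τ then joinPoly (K τ) else 0 := by
    intro T K P _
    refine (map_sum joinLin _ _).trans (Finset.sum_congr rfl fun τ _ => ?_)
    rw [apply_ite joinLin, map_zero]
    rfl
  have hcast : ∀ p : MarkPoly, p * ((b : MarkPoly) + 1) = ((b : ℚ) + 1) • p := by
    intro p
    rw [MvPolynomial.smul_eq_C_mul, mul_comm]
    simp
  have hfac : ((b : ℚ) + 1) * (1 / ((a + 1).factorial : ℚ) * (1 / ((b + 1).factorial : ℚ))) =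
      1 / ((a + 1).factorial : ℚ) * (1 / (b.factorial : ℚ)) := by
    rw [Nat.factorial_succ b]
    have h1 : ((b : ℚ) + 1) ≠ 0 := by positivity
    have h2 : ((b.factorial : ℕ) : ℚ) ≠ 0 := by positivity
    have h3 : (((a + 1).factorial : ℕ) : ℚ) ≠ 0 := by positivity
    push_cast
    field_simp
  rw [hsum, hb, hcast, smul_smul, hfac, smul_add, cutPoly_smul, hcut]
  congr 1
  by_cases hu : 2 ≤ m SeriesVar.u
  · rw [if_pos hu, joinPoly_smul, hjoin]
    congr 1
    refine Finset.sum_congr rfl fun τ _ => if_congr ?_ rfl rfl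
    simp only [Finsupp.coe_tsub, Pi.sub_apply, Finsupp.single_eq_same]
    omega
  -- A join raises the exponent of u by two, so exponents below two receive no joins.
  · rw [if_neg hu, Finset.sum_eq_zero, smul_zero]
    intro τ _
    rw [if_neg]
    omega

theorem cut_add_join_seriesB :
    cutOp seriesB + MvPowerSeries.X SeriesVar.u ^ 2 * joinOp seriesB =
      MvPowerSeries.pderiv MarkPoly SeriesVar.y seriesB := by
  ext1 m
  rw [coeff_cut_add_join, MvPowerSeries.coeff_pderiv, coeff_seriesB_recursion]

/-- A solution of the differential equation is determined by its value at `y = 0`. -/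
theorem eq_of_cut_add_join {F G : DipoleSeries}
    (hF : cutOp F + MvPowerSeries.X SeriesVar.u ^ 2 * joinOp F =
      MvPowerSeries.pderiv MarkPoly SeriesVar.y F)
    (hG : cutOp G + MvPowerSeries.X SeriesVar.u ^ 2 * joinOp G =
      MvPowerSeries.pderiv MarkPoly SeriesVar.y G)
    (h0 : atYZero F = atYZero G) : F = G := by
  have key : ∀ k (m : SeriesVar →₀ ℕ), m SeriesVar.y = k →
      MvPowerSeries.coeff m F = MvPowerSeries.coeff m G := by
    intro k
    induction k with
    | zero =>
      intro m hm
      have h : (if m SeriesVar.y = 0 then MvPowerSeries.coeff m F else 0) =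
          if m SeriesVar.y = 0 then MvPowerSeries.coeff m G else 0 := congrFun h0 m
      rwa [if_pos hm, if_pos hm] at h
    | succ k ih =>
      intro m hm
      obtain ⟨n, rfl⟩ : ∃ n, m = n + Finsupp.single SeriesVar.y 1 :=
        ⟨m - Finsupp.single SeriesVar.y 1, by
          rw [tsub_add_cancel_of_le]
          rw [Finsupp.single_le_iff]
          omega⟩
      have hn : n SeriesVar.y = k := by simpa using hm
      have h1 := congrArg (MvPowerSeries.coeff n) hF
      have h2 := congrArg (MvPowerSeries.coeff n) hG
      rw [coeff_cut_add_join, MvPowerSeries.coeff_pderiv] at h1 h2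
      rw [ih n hn, ih (n - _) (by simp [hn]), h2] at h1
      -- C' and J' do not change the exponent of y, so the left sides agree by induction. On the
      -- right the unknown coefficient at `y^(k+1)` carries the factor `k + 1`, which is nonzero in
      -- characteristic zero.
      refine (mul_right_cancel₀ ?_ h1).symm
      exact Nat.cast_add_one_ne_zero (n SeriesVar.y)
  ext1 m
  exact key _ m rfl

end JoinCut

end

theorem mainTheorem2 (F : JoinCut.DipoleSeries) :
    (JoinCut.cutOp F + MvPowerSeries.X JoinCut.SeriesVar.u ^ 2 * JoinCut.joinOp F =
          MvPowerSeries.pderiv JoinCut.MarkPoly JoinCut.SeriesVar.y F ∧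
        JoinCut.atYZero F = JoinCut.seriesA) ↔
      F = JoinCut.seriesB := by
  constructor
  · rintro ⟨h1, h2⟩
    exact JoinCut.eq_of_cut_add_join h1 JoinCut.cut_add_join_seriesB
      (h2.trans JoinCut.atYZero_seriesB.symm)
  · rintro rfl
    exact ⟨JoinCut.cut_add_join_seriesB, JoinCut.atYZero_seriesB⟩
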